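/- Let $n\ge 1$. Write $\langle z,w\rangle=\sum_j z_jw_j$ for the bilinear form on $\mathbb C^m$, $|z|$ for the Hermitian norm, and $|z|_{\mathbb C}$ for the principal square root of $\langle z,z\rangle$ (positive real part off the cut $(-\infty,0]$, $|0|_{\mathbb C}=0$). Let $\|z\|_{L_m}=\bigl(|z|^2+\sqrt{|z|^4-|\langle z,z\rangle|^2}\bigr)^{1/2}$ be the Lie norm, $L_m=\{z\in\mathbb C^m:\|z\|_{L_m}<1\}$ the Lie ball, $S^{m-1}$ the unit sphere of $\mathbb R^m$, and $\Sigma_n=\{e^{i\theta}\omega:\theta\in\mathbb R,\ \omega\in S^{n-1}\}\subset\mathbb C^n$ the Lie sphere. Let $\mathbb C_{(n)}$ be the complex Clifford algebra with generators $e_1,\dots,e_n$, $e_j^2=-1$, $e_je_k=-e_ke_j$ $(j\ne k)$, $e_0=1$, and identify $(z_0,\dots,z_n)\in\mathbb C^{n+1}$ with $\sum_{j=0}^n z_je_j\in\mathbb C_{(n)}$. A $\mathbb C^{n+1}$-valued function $f=\sum_j f_je_j$ on an open set $U\subseteq\mathbb C^{n+1}$ is left complex regular if it is continuously (complex) differentiable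 and $Df=\sum_{i,j=0}^n(\partial_if_j)\,e_ie_j=0$ on $U$. A function on $\Sigma_n$ is analytic if it extends to a holomorphic function on an open subset of $\mathbb C^n$ containing $\Sigma_n$. Put $N(k,m)=\frac{(2k+m-2)(k+m-3)!}{k!\,(m-2)!}$ for $m\ge3$, and define the Legendre polynomials $P_{k,m}$ by $(1-2tr+r^2)^{-\frac{m-2}2}=\sum_{k\ge0}\frac{m-2}{2k+m-2}N(k,m)P_{k,m}(t)r^k$. There is a unique function $F:\Sigma_n\times L_{n+1}\to\mathbb C^{n+1}$ such that $F(\cdot,z)$ is analytic on $\Sigma_n$ for each $z\in L_{n+1}$, $F(\sigma,\cdot)$ is left complex regular on $L_{n+1}$ for each $\sigma\in\Sigma_n$, and $$F\bigl(e^{i\theta}\omega,(0,z)\bigr)=|\omega-e^{-i\theta}z|_{\mathbb C}^{-n}\,e_0\qquad(\theta\in\mathbb R,\ \omega\in S^{n-1},\ z\in L_n).$$ Moreover, $F$ extends to a holomorphic function on an open neighbourhood of $\Sigma_n\times L_{n+1}$ in $\mathbb C^n\times\mathbb C^{n+1}$, and the following hold. (i) For all $k\ge0$ and $\omega\in S^{n-1}$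 there is a unique left complex regular function $W_{k,n+2}(\omega;\cdot):\mathbb C^{n+1}\to\mathbb C^{n+1}$ whose components are homogeneous polynomials of degree $k$ and which satisfies $W_{k,n+2}(\omega;(0,z))=|z|_{\mathbb C}^kP_{k,n+2}(\langle\omega,z/|z|_{\mathbb C}\rangle)\,e_0$ for all $z\in\mathbb C^n$ with $|z|_{\mathbb C}\neq0$. (ii) For all $\theta\in\mathbb R$, $\omega\in S^{n-1}$ and $\zeta\in L_{n+1}$, $$F(e^{i\theta}\omega,\zeta)=\sum_{k=0}^\infty\frac{n}{2k+n}N(k,n+2)\,e^{-ik\theta}\,W_{k,n+2}(\omega;\zeta),$$ where the series converges unconditionally. (iii) As $k\to\infty$, $\sup_{x\in S^n}|W_{k,n+2}(\omega;x)|=O(k^2)$ uniformly in $\omega\in S^{n-1}$, and $N(k,n+2)=O(k^n)$. Moreover $|W_{k,n+2}(\omega;\zeta)|\le\|\zeta\|_{L_{n+1}}^k\sup_{x\in S^n}|W_{k,n+2}(\omega;x)|$ for all $k\ge0$, $\omega\in S^{n-1}$ and $\zeta\in\mathbb C^{n+1}$. -/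

import Mathlib

noncomputable section

namespace LieBallCR

/-- The bilinear form `⟨z, w⟩ = z₁ w₁ + ⋯ + z_m w_m` on `ℂ^m` (no complex conjugation). -/
def bilin {m : ℕ} (z w : Fin m → ℂ) : ℂ := ∑ i, z i * w i

/-- The Hermitian (Euclidean) norm `|z|` on `ℂ^m`. -/
def hnorm {m : ℕ} (z : Fin m → ℂ) : ℝ := Real.sqrt (∑ i, ‖z i‖ ^ 2)

/-- `|z|_ℂ`, the square root of `z₁² + ⋯ + z_m²` with positive real part off the cut `(-∞, 0]`
(principal branch), with `|0|_ℂ = 0`. -/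
def cnorm {m : ℕ} (z : Fin m → ℂ) : ℂ := (bilin z z) ^ (1 / 2 : ℂ)

/-- The square of the Lie norm, `|z|² + √(|z|⁴ - ||z|_ℂ²|²)`. -/
def lieNormSq {m : ℕ} (z : Fin m → ℂ) : ℝ :=
  hnorm z ^ 2 + Real.sqrt (hnorm z ^ 4 - ‖bilin z z‖ ^ 2)

/-- The Lie norm on `ℂ^m`. -/
def lieNorm {m : ℕ} (z : Fin m → ℂ) : ℝ := Real.sqrt (lieNormSq z)

/-- The Lie ball `L_m` in `ℂ^m`. -/
def lieBall (m : ℕ) : Set (Fin m → ℂ) := {z | lieNormSq z < 1}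

/-- The Euclidean unit sphere `S^{m-1}` of `ℝ^m`. -/
def unitSphere (m : ℕ) : Set (Fin m → ℝ) := {x | ∑ i, x i ^ 2 = 1}

/-- The inclusion `ℝ^m ⊆ ℂ^m`. -/
def toC {m : ℕ} (x : Fin m → ℝ) : Fin m → ℂ := fun i => (x i : ℂ)

/-- The point `e^{iθ} ω` of `ℂ^m`. -/
def lieSpherePoint {m : ℕ} (θ : ℝ) (ω : Fin m → ℝ) : Fin m → ℂ :=
  Complex.exp (Complex.I * θ) • toC ω

/-- The Lie sphere `Σ = {e^{iθ} ω : θ ∈ ℝ, ω ∈ S^{m-1}}` in `ℂ^m`. -/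
def lieSphere (m : ℕ) : Set (Fin m → ℂ) :=
  {σ | ∃ θ : ℝ, ∃ ω ∈ unitSphere m, σ = lieSpherePoint θ ω}

/-- The quadratic form `x ↦ -(x₁² + ⋯ + x_n²)` on `ℂ^n`. -/
def cliffQ (n : ℕ) : QuadraticForm ℂ (Fin n → ℂ) :=
  QuadraticMap.weightedSumSquares ℂ (fun _ : Fin n => (-1 : ℂ))

/-- The complex Clifford algebra `ℂ_(n)` with `n` generators `e_j`, `e_j² = -1`. -/
abbrev Cliff (n : ℕ) : Type := CliffordAlgebra (cliffQ n)

/-- The elements `e_0 = 1, e_1, …, e_n` of `ℂ_(n)`. They are the basis of the copy of `ℂ^{n+1}`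
in `ℂ_(n)`: the vector `(a_0, …, a_n)` stands for `a_0 e_0 + ⋯ + a_n e_n`. -/
def cliffE {n : ℕ} (i : Fin (n + 1)) : Cliff n :=
  Fin.cases 1 (fun j => CliffordAlgebra.ι (cliffQ n) (Pi.single j 1)) i

/-- The operator `D f = ∑_i ∑_j (∂_i f_j) e_i e_j` with values in `ℂ_(n)`, for a `ℂ^{n+1}`-valued
function `f = ∑_j f_j e_j` of `n + 1` complex variables `(z_0, …, z_n)`. -/
def dirac {n : ℕ} (f : (Fin (n + 1) → ℂ) → (Fin (n + 1) → ℂ)) (z : Fin (n + 1) → ℂ) : Cliff n :=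
  ∑ i, ∑ j, (fderiv ℂ f z (Pi.single i 1) j) • ((cliffE i : Cliff n) * cliffE j)

/-- Left complex regular `ℂ^{n+1}`-valued functions on an open subset `U` of `ℂ^{n+1}`. -/
def LeftComplexRegularOn {n : ℕ} (f : (Fin (n + 1) → ℂ) → (Fin (n + 1) → ℂ))
    (U : Set (Fin (n + 1) → ℂ)) : Prop :=
  ContDiffOn ℂ 1 f U ∧ ∀ z ∈ U, dirac f z = 0

/-- Analytic functions on the Lie sphere: those that extend to a holomorphic function on an open
subset of `ℂ^n` containing it. -/
def AnalyticOnLieSphere {n m : ℕ} (f : (Fin n → ℂ) → (Fin m → ℂ)) : Prop :=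
  ∃ U : Set (Fin n → ℂ), IsOpen U ∧ lieSphere n ⊆ U ∧
    ∃ g : (Fin n → ℂ) → (Fin m → ℂ), DifferentiableOn ℂ g U ∧ ∀ σ ∈ lieSphere n, f σ = g σ

/-- Functions on `Σ_n × L_{n+1}` that extend to a holomorphic function on an open
neighbourhood of this set in `ℂ^n × ℂ^{n+1}`. -/
def JointlyAnalytic {n : ℕ} (F : (Fin n → ℂ) → (Fin (n + 1) → ℂ) → (Fin (n + 1) → ℂ)) : Prop :=
  ∃ V : Set ((Fin n → ℂ) × (Fin (n + 1) → ℂ)), IsOpen V ∧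
    lieSphere n ×ˢ lieBall (n + 1) ⊆ V ∧
    ∃ G : (Fin n → ℂ) × (Fin (n + 1) → ℂ) → (Fin (n + 1) → ℂ),
      DifferentiableOn ℂ G V ∧
      ∀ σ ∈ lieSphere n, ∀ z ∈ lieBall (n + 1), F σ z = G (σ, z)

/-- The Cauchy–Hua kernel `|ω - e^{-iθ} z|_ℂ^{-n}`. -/
def cauchyHua {n : ℕ} (θ : ℝ) (ω : Fin n → ℝ) (z : Fin n → ℂ) : ℂ :=
  (cnorm (toC ω - Complex.exp (-(Complex.I * θ)) • z) ^ n)⁻¹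

/-- `F` is a `ℂ^{n+1}`-valued function on `Σ_n × L_{n+1}`, analytic on `Σ_n` and left complex
regular on `L_{n+1}`, equal to the Cauchy–Hua kernel times `e_0` on `{0} × L_n`. -/
structure IsRegularExtension {n : ℕ}
    (F : (Fin n → ℂ) → (Fin (n + 1) → ℂ) → (Fin (n + 1) → ℂ)) : Prop where
  analytic : ∀ z ∈ lieBall (n + 1), AnalyticOnLieSphere (fun σ => F σ z)
  regular : ∀ σ ∈ lieSphere n, LeftComplexRegularOn (F σ) (lieBall (n + 1))
  extends_kernel : ∀ (θ : ℝ), ∀ ω ∈ unitSphere n, ∀ z ∈ lieBall n,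
    F (lieSpherePoint θ ω) (Fin.cons 0 z) = Fin.cons (cauchyHua θ ω z) 0

/-- `N(k, m) = (2k + m - 2) (k + m - 3)! / (k! (m - 2)!)`, used for `m ≥ 3`: the dimension of the
space of spherical harmonics of degree `k` on `S^{m-1}`. -/
def dimHarm (k m : ℕ) : ℝ :=
  ((2 * k + m - 2 : ℕ) * (k + m - 3).factorial : ℝ) / (k.factorial * (m - 2).factorial)

/-- The Legendre polynomials `P_{k,m}` of dimension `m ≥ 3`, evaluated at complex arguments. The
generating formula
`(1 - 2tr + r²)^{-(m-2)/2} = ∑_k (m-2)/(2k+m-2) N(k,m) P_{k,m}(t) r^k`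
defines them through the Taylor coefficients in `r` at `0` of its left-hand side. -/
def legendreP (k m : ℕ) (t : ℂ) : ℂ :=
  (2 * (k : ℂ) + m - 2) / (((m : ℂ) - 2) * (dimHarm k m : ℂ)) *
    (iteratedDeriv k (fun r : ℂ => (1 - 2 * t * r + r ^ 2) ^ (-(((m : ℂ) - 2) / 2))) 0 /
      (k.factorial : ℂ))

/-- `W` is a `ℂ^{n+1}`-valued homogeneous polynomial of degree `k` on `ℂ^{n+1}` that is left
complex regular and extends `z ↦ |z|_ℂ^k P_{k,n+2}(⟨ω, z / |z|_ℂ⟩)`, `z ∈ ℂ^n`. The extension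
property is imposed on the dense set where the quotient makes sense. -/
structure IsHomogeneousRegularExtension {n : ℕ} (k : ℕ) (ω : Fin n → ℝ)
    (W : (Fin (n + 1) → ℂ) → (Fin (n + 1) → ℂ)) : Prop where
  homogeneous : ∀ j, ∃ p : MvPolynomial (Fin (n + 1)) ℂ, p.IsHomogeneous k ∧
    ∀ z, W z j = MvPolynomial.eval z p
  regular : LeftComplexRegularOn W Set.univ
  extends_legendre : ∀ z : Fin n → ℂ, cnorm z ≠ 0 →
    W (Fin.cons 0 z) =
      Fin.cons (cnorm z ^ k * legendreP k (n + 2) (bilin (toC ω) ((cnorm z)⁻¹ • z))) 0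

end LieBallCR

end
open LieBallCR

/-!
The kernel is expanded in homogeneous polynomials, each of which has an explicit regular extension.

Let `C_k` be the Gegenbauer polynomial of index `n / 2`, homogenized (`geg`): `C_k(p, c)` is the
coefficient of `r^k` in `(1 - 2 p r + c r²)^{-n/2}`. A map `(∂₀V, -∂₁V, …, -∂ₙV)` is left complex
regular as soon as `V` is harmonic (`leftComplexRegularOn_conjGrad`), so a scalar function `h` of
`z' = (z₁, …, zₙ)` is extended by taking for `V` the harmonic function that is odd in `z₀` and
has normal derivative `h`. For `h(z') = C_k(⟨σ, z'⟩, ⟨σ, σ⟩ ⟨z', z'⟩)` this is the polynomial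
`potential k σ`, namely `∫_0^{z₀} C_k(⟨σ, z'⟩, ⟨σ, σ⟩ (⟨z, z⟩ - y²)) dy`
(`laplacian_potential`). Its conjugate gradient is `regPoly k σ`, homogeneous of degree `k` in
`σ` and in `z`, and `W_{k,n+2}(ω; ·)` is `regPoly k ω` divided by `C_k(1, 1)`.

The generating function of the Gegenbauer polynomials (`hasSum_geg`) gives
`F(e^{iθ} ω, z) = ∑_k regPoly k (e^{-iθ} ω) z` on `z₀ = 0`. Convergence on the whole Lie ball is a
matter of estimates. On real unit spheres the potential is at most `C_k(1, 1)`, by its integral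
representation and positivity of the Gegenbauer coefficients (`norm_eval_potential_le`). A
homogeneous entire map of degree `k` bounded by `M` on the real unit sphere is bounded by
`‖z‖_L^k M` at `z`, `‖·‖_L` being the Lie norm: on a suitable complex line this is the maximum
principle on the unit disc, whose boundary circle is mapped to unimodular multiples of real vectors
of the unit ball (`norm_le_lieNorm_pow_mul`). Together with Cauchy's estimate on discs of radius
`1 / (k + 1)` this bounds the gradient of the potential with a loss of `O(k)`
(`norm_fderiv_single_le_of_homogeneous`). Hence the series is dominated by a convergent series
locally near `Σ_n × L_{n+1}`, with `σ / ⟨σ, σ⟩` as holomorphic replacement of the conjugate of `σ`,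
and can be differentiated term by term (`contDiffOn_tsum_of_locally_bounded`).

For uniqueness, the scalar and the vector part of the equation `D f = 0` express `∂₀ f` through the
other partial derivatives (`eq_of_sum_smul_cliffE_mul_eq_zero`), so a regular map that vanishes for
`z₀ = 0` vanishes near the origin by the Cauchy–Kovalevskaya majorant argument, and then
everywhere by analytic continuation along complex lines through the origin (`eqOn_of_regular`).
-/

namespace LieBallCR

/-! ### The operator `D` in components -/

lemma cliffE_zero {n : ℕ} : (cliffE 0 : Cliff n) = 1 := rfl

lemma cliffE_succ {n : ℕ} (j : Fin n) :
    (cliffE j.succ : Cliff n) = CliffordAlgebra.ι (cliffQ n) (Pi.single j 1) := rfl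

/-- The anticommutation relations of the generators. -/
lemma cliffE_succ_mul_add_swap {n : ℕ} (i j : Fin n) :
    (cliffE i.succ * cliffE j.succ + cliffE j.succ * cliffE i.succ : Cliff n) =
      algebraMap ℂ (Cliff n) (if i = j then -2 else 0) := by
  rw [cliffE_succ, cliffE_succ, CliffordAlgebra.ι_mul_ι_add_swap]
  congr 1
  simp only [QuadraticMap.polar, cliffQ, QuadraticMap.weightedSumSquares_apply, Pi.add_apply,
    smul_eq_mul, ← Finset.sum_sub_distrib]
  by_cases h : i = j
  · subst h
    rw [Finset.sum_eq_single i (fun b _ hb => by simp [Pi.single_eq_of_ne hb]) (by simp)]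
    simp only [Pi.single_eq_same, if_true]; norm_num
  · rw [if_neg h]
    refine Finset.sum_eq_zero fun k _ => ?_
    by_cases hk : k = i
    · subst hk; simp [Pi.single_eq_of_ne h]
    · simp [Pi.single_eq_of_ne hk]

lemma sum_smul_cliffE_succ_add_swap {n : ℕ} (c : Fin n → Fin n → ℂ) :
    ∑ i, ∑ j, c i j • (cliffE i.succ * cliffE j.succ : Cliff n) +
      ∑ i, ∑ j, c i j • (cliffE j.succ * cliffE i.succ : Cliff n) =
      algebraMap ℂ (Cliff n) (-2 * ∑ i, c i i) := by
  simp only [← Finset.sum_add_distrib]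
  have h : ∀ i j : Fin n, c i j • (cliffE i.succ * cliffE j.succ : Cliff n) +
      c i j • (cliffE j.succ * cliffE i.succ : Cliff n) =
      algebraMap ℂ (Cliff n) (c i j * if i = j then -2 else 0) := fun i j => by
    rw [← smul_add, cliffE_succ_mul_add_swap, Algebra.smul_def, ← map_mul]
  simp only [h, ← map_sum]
  congr 1
  simp [Finset.mul_sum, mul_comm]

lemma sum_smul_cliffE_mul_eq {n : ℕ} (c : Fin (n + 1) → Fin (n + 1) → ℂ) :
    ∑ i, ∑ j, c i j • (cliffE i * cliffE j : Cliff n) =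
      algebraMap ℂ (Cliff n) (c 0 0) +
        CliffordAlgebra.ι (cliffQ n) (fun j => c 0 j.succ + c j.succ 0) +
        ∑ i : Fin n, ∑ j : Fin n, c i.succ j.succ • (cliffE i.succ * cliffE j.succ : Cliff n) := by
  have hι : CliffordAlgebra.ι (cliffQ n) (fun j => c 0 j.succ + c j.succ 0) =
      ∑ j : Fin n, (c 0 j.succ + c j.succ 0) • (cliffE j.succ : Cliff n) := by
    conv_lhs => rw [pi_eq_sum_univ' (fun j : Fin n => c 0 j.succ + c j.succ 0)]
    simp only [map_sum, map_smul, cliffE_succ]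
  rw [hι]
  simp only [Fin.sum_univ_succ, cliffE_zero, one_mul, mul_one, add_smul, Finset.sum_add_distrib,
    Algebra.algebraMap_eq_smul_one]
  abel

/-- The generalized Cauchy–Riemann system implies `∑ c_ij e_i e_j = 0`. -/
lemma sum_smul_cliffE_mul_eq_zero {n : ℕ} {c : Fin (n + 1) → Fin (n + 1) → ℂ}
    (h : c 0 0 = ∑ i : Fin n, c i.succ i.succ) (h0 : ∀ j : Fin n, c 0 j.succ = -c j.succ 0)
    (hs : ∀ i j : Fin n, c i.succ j.succ = c j.succ i.succ) :
    ∑ i, ∑ j, c i j • (cliffE i * cliffE j : Cliff n) = 0 := by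
  rw [sum_smul_cliffE_mul_eq]
  have hv : (fun j : Fin n => c 0 j.succ + c j.succ 0) = 0 := by
    funext j; simp [h0]
  rw [hv, map_zero, add_zero]
  have h2 := sum_smul_cliffE_succ_add_swap (fun i j : Fin n => c i.succ j.succ)
  have h3 : ∑ i : Fin n, ∑ j : Fin n, c i.succ j.succ • (cliffE j.succ * cliffE i.succ : Cliff n) =
      ∑ i : Fin n, ∑ j : Fin n, c i.succ j.succ • (cliffE i.succ * cliffE j.succ : Cliff n) := by
    rw [Finset.sum_comm]
    exact Finset.sum_congr rfl fun i _ => Finset.sum_congr rfl fun j _ => by rw [hs]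
  rw [h3, ← two_smul ℂ, ← h] at h2
  have h4 : (2 : ℂ) • (algebraMap ℂ (Cliff n) (c 0 0) + ∑ i : Fin n, ∑ j : Fin n,
      c i.succ j.succ • (cliffE i.succ * cliffE j.succ : Cliff n)) = 0 := by
    rw [smul_add, h2, Algebra.algebraMap_eq_smul_one, Algebra.algebraMap_eq_smul_one, smul_smul,
      ← add_smul]
    simp
  exact (smul_eq_zero.1 h4).resolve_left two_ne_zero

/-- The scalar and the vector part of `∑ c_ij e_i e_j`, separated by the grade involution and
the reversal of the Clifford algebra. -/
lemma eq_of_sum_smul_cliffE_mul_eq_zero {n : ℕ} {c : Fin (n + 1) → Fin (n + 1) → ℂ}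
    (h : ∑ i, ∑ j, c i j • (cliffE i * cliffE j : Cliff n) = 0) :
    c 0 0 = ∑ i : Fin n, c i.succ i.succ ∧ ∀ j : Fin n, c 0 j.succ = -c j.succ 0 := by
  have : Invertible (2 : ℂ) := invertibleOfNonzero two_ne_zero
  rw [sum_smul_cliffE_mul_eq] at h
  have hi := congrArg CliffordAlgebra.involute h
  have hS : CliffordAlgebra.involute (∑ i : Fin n, ∑ j : Fin n,
      c i.succ j.succ • (cliffE i.succ * cliffE j.succ : Cliff n)) = ∑ i : Fin n, ∑ j : Fin n,
      c i.succ j.succ • (cliffE i.succ * cliffE j.succ : Cliff n) := by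
    simp [cliffE_succ]
  rw [map_add, map_add, hS, CliffordAlgebra.involute_ι, AlgHom.commutes, map_zero] at hi
  set S := ∑ i : Fin n, ∑ j : Fin n,
      c i.succ j.succ • (cliffE i.succ * cliffE j.succ : Cliff n) with hSd
  constructor
  · have h1 : algebraMap ℂ (Cliff n) (c 0 0) + S = 0 := by
      have : (2 : ℂ) • (algebraMap ℂ (Cliff n) (c 0 0) + S) = 0 := by
        rw [two_smul]; linear_combination (norm := module) h + hi
      exact (smul_eq_zero.1 this).resolve_left two_ne_zero
    have h2 := congrArg CliffordAlgebra.reverse h1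
    have hr : CliffordAlgebra.reverse S = ∑ i : Fin n, ∑ j : Fin n,
        c i.succ j.succ • (cliffE j.succ * cliffE i.succ : Cliff n) := by
      simp [hSd, cliffE_succ]
    rw [map_add, CliffordAlgebra.reverse.commutes, hr, map_zero] at h2
    have h3 := sum_smul_cliffE_succ_add_swap (fun i j : Fin n => c i.succ j.succ)
    rw [← hSd] at h3
    have h4 : algebraMap ℂ (Cliff n) (2 * c 0 0 - 2 * ∑ i : Fin n, c i.succ i.succ) = 0 := by
      rw [map_sub, two_mul, map_add]
      have h5 : algebraMap ℂ (Cliff n) (-2 * ∑ i : Fin n, c i.succ i.succ) =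
        - algebraMap ℂ (Cliff n) (2 * ∑ i : Fin n, c i.succ i.succ) := by
        rw [← map_neg]; congr 1; ring
      rw [h5] at h3
      rw [← sub_eq_zero] at h3
      linear_combination (norm := module) h1 + h2 - h3
    have h5 : 2 * c 0 0 - 2 * ∑ i : Fin n, c i.succ i.succ = 0 := by
      rwa [map_eq_zero_iff _ (algebraMap ℂ (Cliff n)).injective] at h4
    linear_combination h5 / 2
  · have h1 : CliffordAlgebra.ι (cliffQ n) (fun j => c 0 j.succ + c j.succ 0) = 0 := by
      have : (2 : ℂ) • CliffordAlgebra.ι (cliffQ n) (fun j => c 0 j.succ + c j.succ 0) = 0 := by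
        rw [two_smul]; linear_combination (norm := module) h - hi
      exact (smul_eq_zero.1 this).resolve_left two_ne_zero
    replace h1 := congrArg (CliffordAlgebra.equivExterior (cliffQ n)) h1
    rw [map_zero, CliffordAlgebra.equivExterior, CliffordAlgebra.changeFormEquiv_apply,
      CliffordAlgebra.changeForm_ι] at h1
    replace h1 := (ExteriorAlgebra.ι_eq_zero_iff _).1 h1
    intro j
    have := congrFun h1 j
    simp only [Pi.zero_apply] at this
    linear_combination this

end LieBallCR

namespace LieBallCR

open Complex in
/-! ### The Lie norm -/

lemma bilin_self_re {m : ℕ} (z : Fin m → ℂ) :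
    (bilin z z).re = ∑ i, (z i).re ^ 2 - ∑ i, (z i).im ^ 2 := by
  simp [bilin, Complex.re_sum, ← Finset.sum_sub_distrib, sq]

lemma bilin_self_im {m : ℕ} (z : Fin m → ℂ) :
    (bilin z z).im = 2 * ∑ i, (z i).re * (z i).im := by
  simp only [bilin, Complex.im_sum, Finset.mul_sum, Complex.mul_im]
  exact Finset.sum_congr rfl fun i _ => by ring

lemma hnorm_sq {m : ℕ} (z : Fin m → ℂ) : hnorm z ^ 2 = ∑ i, ‖z i‖ ^ 2 :=
  Real.sq_sqrt (Finset.sum_nonneg fun _ _ => by positivity)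

lemma hnorm_sq' {m : ℕ} (z : Fin m → ℂ) :
    hnorm z ^ 2 = ∑ i, (z i).re ^ 2 + ∑ i, (z i).im ^ 2 := by
  rw [hnorm_sq, ← Finset.sum_add_distrib]
  refine Finset.sum_congr rfl fun i _ => ?_
  rw [← Complex.normSq_eq_norm_sq, Complex.normSq_apply]; ring

lemma hnorm_nonneg {m : ℕ} (z : Fin m → ℂ) : 0 ≤ hnorm z := Real.sqrt_nonneg _

lemma hnorm_eq_norm {m : ℕ} (z : Fin m → ℂ) : hnorm z = ‖WithLp.toLp 2 z‖ := by
  rw [EuclideanSpace.norm_eq]; rfl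

lemma norm_le_hnorm {m : ℕ} (z : Fin m → ℂ) : ‖z‖ ≤ hnorm z := by
  refine (pi_norm_le_iff_of_nonneg (hnorm_nonneg z)).2 fun i => ?_
  refine Real.le_sqrt_of_sq_le ?_
  exact Finset.single_le_sum (f := fun i => ‖z i‖ ^ 2) (fun _ _ => by positivity)
    (Finset.mem_univ i)

lemma hnorm_smul {m : ℕ} (t : ℂ) (z : Fin m → ℂ) : hnorm (t • z) = ‖t‖ * hnorm z := by
  rw [hnorm_eq_norm, hnorm_eq_norm, WithLp.toLp_smul, norm_smul]

lemma bilin_smul_smul {m : ℕ} (s t : ℂ) (z w : Fin m → ℂ) :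
    bilin (s • z) (t • w) = s * t * bilin z w := by
  simp only [bilin, Pi.smul_apply, smul_eq_mul, Finset.mul_sum]
  exact Finset.sum_congr rfl fun i _ => by ring

/-- The squared Lie norm in terms of real and imaginary parts. -/
lemma lieNormSq_eq {m : ℕ} (z : Fin m → ℂ) :
    lieNormSq z = ∑ i, (z i).re ^ 2 + ∑ i, (z i).im ^ 2 +
      2 * Real.sqrt ((∑ i, (z i).re ^ 2) * (∑ i, (z i).im ^ 2) -
        (∑ i, (z i).re * (z i).im) ^ 2) := by
  rw [lieNormSq, show hnorm z ^ 4 = (hnorm z ^ 2) ^ 2 by ring, hnorm_sq',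
    ← Complex.normSq_eq_norm_sq, Complex.normSq_apply, bilin_self_re, bilin_self_im]
  congr 1
  rw [show (2 : ℝ) = Real.sqrt (2 ^ 2) by rw [Real.sqrt_sq (by norm_num)],
    ← Real.sqrt_mul (by norm_num)]
  rw [Real.sqrt_sq (by norm_num)]
  congr 1; ring

lemma lieNormSq_nonneg {m : ℕ} (z : Fin m → ℂ) : 0 ≤ lieNormSq z := by
  unfold lieNormSq; positivity

lemma lieNorm_nonneg {m : ℕ} (z : Fin m → ℂ) : 0 ≤ lieNorm z := Real.sqrt_nonneg _

lemma lieNormSq_smul {m : ℕ} (t : ℂ) (z : Fin m → ℂ) :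
    lieNormSq (t • z) = ‖t‖ ^ 2 * lieNormSq z := by
  rw [lieNormSq, lieNormSq, hnorm_smul, bilin_smul_smul]
  rw [show (‖t‖ * hnorm z) ^ 4 - ‖t * t * bilin z z‖ ^ 2 =
    (‖t‖ ^ 2) ^ 2 * (hnorm z ^ 4 - ‖bilin z z‖ ^ 2) by rw [norm_mul, norm_mul]; ring,
    Real.sqrt_mul (by positivity), Real.sqrt_sq (by positivity)]
  ring

lemma lieNorm_smul {m : ℕ} (t : ℂ) (z : Fin m → ℂ) : lieNorm (t • z) = ‖t‖ * lieNorm z := by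
  rw [lieNorm, lieNormSq_smul, Real.sqrt_mul (by positivity), Real.sqrt_sq (norm_nonneg _), lieNorm]

lemma continuous_lieNormSq {m : ℕ} : Continuous (lieNormSq : (Fin m → ℂ) → ℝ) := by
  unfold lieNormSq hnorm bilin; fun_prop

lemma continuous_lieNorm {m : ℕ} : Continuous (lieNorm : (Fin m → ℂ) → ℝ) :=
  continuous_lieNormSq.sqrt

lemma isOpen_lieBall (m : ℕ) : IsOpen (lieBall m) :=
  isOpen_lt continuous_lieNormSq continuous_const

lemma lieNormSq_zero {m : ℕ} : lieNormSq (0 : Fin m → ℂ) = 0 := by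
  have := lieNormSq_smul 0 (0 : Fin m → ℂ); simpa using this

lemma zero_mem_lieBall (m : ℕ) : (0 : Fin m → ℂ) ∈ lieBall m := by
  simp [lieBall, lieNormSq_zero]

lemma mem_lieBall_iff {m : ℕ} {z : Fin m → ℂ} : z ∈ lieBall m ↔ lieNorm z < 1 := by
  rw [lieBall, Set.mem_ofPred_eq, lieNorm, Real.sqrt_lt' one_pos, one_pow]

lemma lieNormSq_cons_zero {m : ℕ} (z : Fin m → ℂ) :
    lieNormSq (Fin.cons 0 z : Fin (m + 1) → ℂ) = lieNormSq z := by
  simp [lieNormSq_eq, Fin.sum_univ_succ]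

lemma lieNorm_toC {m : ℕ} {x : Fin m → ℝ} (hx : x ∈ unitSphere m) : lieNorm (toC x) = 1 := by
  have hx' : ∑ i, x i ^ 2 = 1 := hx
  simp [lieNorm, lieNormSq_eq, toC, hx']

lemma bilin_toC_self {m : ℕ} {x : Fin m → ℝ} (hx : x ∈ unitSphere m) :
    bilin (toC x) (toC x) = 1 := by
  have hx' : ∑ i, x i ^ 2 = 1 := hx
  simp only [bilin, toC, ← sq]
  exact_mod_cast hx'

lemma sum_sq_combination_nonneg {m : ℕ} (u v w : Fin m → ℝ) (r s t : ℝ) :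
    0 ≤ r ^ 2 * ∑ i, u i ^ 2 + s ^ 2 * ∑ i, v i ^ 2 + t ^ 2 * ∑ i, w i ^ 2 +
      2 * r * s * ∑ i, u i * v i + 2 * r * t * ∑ i, u i * w i + 2 * s * t * ∑ i, v i * w i := by
  have h : 0 ≤ ∑ i, (r * u i + s * v i + t * w i) ^ 2 := Finset.sum_nonneg fun _ _ => sq_nonneg _
  convert h using 1
  simp only [Finset.mul_sum, ← Finset.sum_add_distrib]
  exact Finset.sum_congr rfl fun i _ => by ring

/-- The isotropic cone with a vertex on the real unit sphere does not meet the Lie ball. -/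
lemma one_le_lieNormSq_of_bilin_sub_eq_zero {m : ℕ} {ω : Fin m → ℝ} (hω : ω ∈ unitSphere m)
    {z : Fin m → ℂ} (h : bilin (toC ω - z) (toC ω - z) = 0) : 1 ≤ lieNormSq z := by
  have hω' : ∑ i, ω i ^ 2 = 1 := hω
  set u : Fin m → ℝ := fun i => (z i).re with hu
  set v : Fin m → ℝ := fun i => (z i).im with hv
  have hre := congrArg Complex.re h
  have him := congrArg Complex.im h
  rw [bilin_self_re] at hre
  rw [bilin_self_im] at him
  simp only [toC, Pi.sub_apply, Complex.sub_re, Complex.ofReal_re, Complex.sub_im,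
    Complex.ofReal_im, Complex.zero_re, Complex.zero_im, zero_sub, neg_sq, mul_neg] at hre him
  set a := ∑ i, u i ^ 2 with ha
  set b := ∑ i, v i ^ 2 with hb
  set d := ∑ i, u i * v i with hd
  set α := ∑ i, ω i * u i with hα
  set β := ∑ i, ω i * v i with hβ
  have h1 : 1 - 2 * α + a = b := by
    have : ∑ i, (ω i - (z i).re) ^ 2 = 1 - 2 * α + a := by
      rw [← hω', ha, hα, Finset.mul_sum, ← Finset.sum_sub_distrib, ← Finset.sum_add_distrib]
      exact Finset.sum_congr rfl fun i _ => by simp only [hu]; ring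
    linarith
  have h2 : β = d := by
    have : ∑ x, -((ω x - (z x).re) * (z x).im) = d - β := by
      rw [hd, hβ, ← Finset.sum_sub_distrib]
      exact Finset.sum_congr rfl fun i _ => by simp only [hu, hv]; ring
    linarith
  have hb0 : 0 ≤ b := Finset.sum_nonneg fun _ _ => sq_nonneg _
  have hb1 := sum_sq_combination_nonneg ω u v
  simp only [hω', ← ha, ← hb, ← hd, ← hα, ← hβ] at hb1
  -- Bessel's inequality for the orthogonal vectors `ω - u` and `v`, both of squared norm `b`
  have hB : (1 - α) ^ 2 + β ^ 2 ≤ b := by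
    rcases hb0.eq_or_lt with h0 | h0
    · have e1 := hb1 (1 - (1 - α)) (-1) 0
      have e2 := hb1 (-β) 0 1
      nlinarith
    · -- the squared norm of `b ω - (1 - α) (ω - u) - β v`
      have e1 := hb1 (b - (1 - α)) (1 - α) (-β)
      have : 0 ≤ b * (b - ((1 - α) ^ 2 + β ^ 2)) := by
        convert e1 using 1
        have ea : a = b - 1 + 2 * α := by linarith
        rw [ea, ← h2]; ring
      exact sub_nonneg.1 ((mul_nonneg_iff_of_pos_left h0).1 this)
  rw [lieNormSq_eq]
  change 1 ≤ a + b + 2 * Real.sqrt (a * b - d ^ 2)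
  rcases le_or_gt 1 (a + b) with h3 | h3
  · have := Real.sqrt_nonneg (a * b - d ^ 2); linarith
  · have : (1 - a - b) / 2 ≤ Real.sqrt (a * b - d ^ 2) := by
      apply Real.le_sqrt_of_sq_le
      have eα : α = (1 + a - b) / 2 := by linarith
      rw [eα, h2] at hB
      nlinarith
    linarith

/-! ### The maximum principle for homogeneous entire maps -/

/-- A homogeneous map bounded on the unit sphere is bounded on real vectors. -/
lemma norm_toC_le_of_homogeneous {m k : ℕ} {E : Type*} [NormedAddCommGroup E] [NormedSpace ℂ E]
    (hm : 0 < m) {f : (Fin m → ℂ) → E} (hom : ∀ (t : ℂ) z, f (t • z) = t ^ k • f z) {M : ℝ}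
    (hM : ∀ x ∈ unitSphere m, ‖f (toC x)‖ ≤ M) (x : Fin m → ℝ) :
    ‖f (toC x)‖ ≤ Real.sqrt (∑ i, x i ^ 2) ^ k * M := by
  set r := Real.sqrt (∑ i, x i ^ 2) with hr
  have hr0 : 0 ≤ r := Real.sqrt_nonneg _
  have hr2 : r ^ 2 = ∑ i, x i ^ 2 := Real.sq_sqrt (Finset.sum_nonneg fun _ _ => sq_nonneg _)
  obtain ⟨y, hy, hxy⟩ : ∃ y ∈ unitSphere m, toC x = (r : ℂ) • toC y := by
    rcases hr0.eq_or_lt with h | h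
    · refine ⟨Pi.single ⟨0, hm⟩ 1, ?_, ?_⟩
      · simp only [unitSphere, Set.mem_ofPred_eq, Pi.single_apply]
        simp
      · funext i
        rw [← h] at hr2
        have := (Finset.sum_eq_zero_iff_of_nonneg (fun i _ => sq_nonneg (x i))).1
          (by simpa using hr2.symm) i (Finset.mem_univ i)
        have hx : x i = 0 := by simpa using this
        simp [toC, ← h, hx]
    · refine ⟨fun i => x i / r, ?_, ?_⟩
      · simp only [unitSphere, Set.mem_ofPred_eq, div_pow, ← Finset.sum_div, ← hr2]
        field_simp
      · funext i
        have : (r : ℂ) ≠ 0 := by exact_mod_cast h.ne'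
        simp only [toC, Pi.smul_apply, smul_eq_mul, Complex.ofReal_div]
        field_simp
  rw [hxy, hom, norm_smul, norm_pow, Complex.norm_real, Real.norm_of_nonneg hr0]
  exact mul_le_mul_of_nonneg_left (hM y hy) (by positivity)

/-- Every vector of `ℂ^m` is a unimodular multiple of one whose real and imaginary parts are
orthogonal, the real part being the longer one. -/
lemma exists_unimodular_bilin_nonneg {m : ℕ} (z : Fin m → ℂ) :
    ∃ ε : ℂ, ∃ w : Fin m → ℂ, ‖ε‖ = 1 ∧ z = ε • w ∧ 0 ≤ (bilin w w).re ∧ (bilin w w).im = 0 := by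
  obtain ⟨ε, hε, h⟩ : ∃ ε : ℂ, ‖ε‖ = 1 ∧ bilin z z = ε ^ 2 * ‖bilin z z‖ := by
    by_cases h0 : bilin z z = 0
    · exact ⟨1, by simp, by simp [h0]⟩
    · obtain ⟨ε, hε⟩ := IsAlgClosed.exists_pow_nat_eq (bilin z z / ‖bilin z z‖) two_pos
      have hn : (‖bilin z z‖ : ℂ) ≠ 0 := by simpa using h0
      refine ⟨ε, ?_, by rw [hε]; field_simp⟩
      have := congrArg norm hε
      rw [norm_pow, norm_div, Complex.norm_real, norm_norm, div_self (by simpa using h0)] at this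
      exact (pow_eq_one_iff_of_nonneg (norm_nonneg _) two_ne_zero).1 this
  have hε0 : ε ≠ 0 := norm_ne_zero_iff.1 (by rw [hε]; exact one_ne_zero)
  have hw : bilin (ε⁻¹ • z) (ε⁻¹ • z) = (‖bilin z z‖ : ℂ) := by
    rw [bilin_smul_smul]
    conv_lhs => rw [h]
    field_simp
  refine ⟨ε, ε⁻¹ • z, hε, by rw [smul_smul, mul_inv_cancel₀ hε0, one_smul], ?_, ?_⟩
  · rw [hw]; simp
  · rw [hw]; simp

/-- Maximum principle for homogeneous entire maps: the Lie norm measures the growth from the real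
unit sphere. For `z = x + i y` with `x ⊥ y`, the span of `u = x / |x|` and `v = y / |y|` contains
a complex line through a multiple of `z` whose unit circle `s = η²` consists of the vectors
`η (η₁ u + η₂ v)`, `η = η₁ + i η₂`. -/
theorem norm_le_lieNorm_pow_mul {m k : ℕ} {E : Type*} [NormedAddCommGroup E] [NormedSpace ℂ E]
    (hm : 0 < m) {f : (Fin m → ℂ) → E} (hf : Differentiable ℂ f)
    (hom : ∀ (t : ℂ) z, f (t • z) = t ^ k • f z) {M : ℝ}
    (hM : ∀ x ∈ unitSphere m, ‖f (toC x)‖ ≤ M) (z : Fin m → ℂ) :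
    ‖f z‖ ≤ lieNorm z ^ k * M := by
  have hreal := norm_toC_le_of_homogeneous hm hom hM
  have hM0 : 0 ≤ M := by
    refine (norm_nonneg _).trans (hM (Pi.single ⟨0, hm⟩ 1) ?_)
    simp only [unitSphere, Set.mem_ofPred_eq, Pi.single_apply]
    simp
  obtain ⟨ε, w, hε, rfl, hre, him⟩ := exists_unimodular_bilin_nonneg z
  rw [hom, norm_smul, norm_pow, lieNorm_smul, hε, one_pow, one_mul, one_mul]
  rw [bilin_self_re] at hre
  rw [bilin_self_im] at him
  set x : Fin m → ℝ := fun i => (w i).re with hx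
  set y : Fin m → ℝ := fun i => (w i).im with hy
  have hw : w = toC x + Complex.I • toC y := by
    funext i; simp [toC, hx, hy, mul_comm Complex.I, Complex.re_add_im]
  have hd : ∑ i, x i * y i = 0 := by simpa using him
  set α := Real.sqrt (∑ i, x i ^ 2) with hα
  set β := Real.sqrt (∑ i, y i ^ 2) with hβ
  have hα2 : α ^ 2 = ∑ i, x i ^ 2 := Real.sq_sqrt (Finset.sum_nonneg fun _ _ => sq_nonneg _)
  have hβ2 : β ^ 2 = ∑ i, y i ^ 2 := Real.sq_sqrt (Finset.sum_nonneg fun _ _ => sq_nonneg _)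
  have hα0 : 0 ≤ α := Real.sqrt_nonneg _
  have hβ0 : 0 ≤ β := Real.sqrt_nonneg _
  have hβα : β ≤ α := Real.sqrt_le_sqrt (by linarith)
  have hL : lieNorm w = α + β := by
    rw [lieNorm, lieNormSq_eq]
    change Real.sqrt (∑ i, x i ^ 2 + ∑ i, y i ^ 2 +
      2 * Real.sqrt ((∑ i, x i ^ 2) * (∑ i, y i ^ 2) - (∑ i, x i * y i) ^ 2)) = α + β
    rw [hd, ← hα2, ← hβ2, show α ^ 2 * β ^ 2 - 0 ^ 2 = (α * β) ^ 2 by ring,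
      Real.sqrt_sq (by positivity), show α ^ 2 + β ^ 2 + 2 * (α * β) = (α + β) ^ 2 by ring,
      Real.sqrt_sq (by positivity)]
  have hy0 : β = 0 → y = 0 := fun h => by
    funext i
    rw [h] at hβ2
    have := (Finset.sum_eq_zero_iff_of_nonneg (fun i _ => sq_nonneg (y i))).1
      (by simpa using hβ2.symm) i (Finset.mem_univ i)
    simpa using this
  rw [hL]
  rcases hα0.eq_or_lt with h0 | h0
  · have hβz : β = 0 := le_antisymm (hβα.trans h0.symm.le) hβ0
    have hw0 : w = toC x := by rw [hw, hy0 hβz]; funext i; simp [toC]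
    rw [hw0, hβz, add_zero]
    exact hreal x
  have hs : 0 < α + β := by positivity
  -- `u` and `v` have norm at most one, even if `β = 0`
  set u : Fin m → ℝ := α⁻¹ • x with hu
  set v : Fin m → ℝ := β⁻¹ • y with hv
  have hu1 : ∑ i, u i ^ 2 = 1 := by
    simp only [hu, Pi.smul_apply, smul_eq_mul, mul_pow, ← Finset.mul_sum, ← hα2]
    field_simp
  have hv1 : ∑ i, v i ^ 2 ≤ 1 := by
    simp only [hv, Pi.smul_apply, smul_eq_mul, mul_pow, ← Finset.mul_sum, ← hβ2]
    rcases hβ0.eq_or_lt with h | h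
    · simp [← h]
    · rw [← mul_pow, inv_mul_cancel₀ h.ne', one_pow]
  have huv : ∑ i, u i * v i = 0 := by
    have : ∑ i, u i * v i = α⁻¹ * β⁻¹ * ∑ i, x i * y i := by
      rw [Finset.mul_sum]
      exact Finset.sum_congr rfl fun i _ => by simp only [hu, hv, Pi.smul_apply, smul_eq_mul]; ring
    rw [this, hd, mul_zero]
  have hαu : toC x = (α : ℂ) • toC u := by
    have : (α : ℂ) ≠ 0 := by exact_mod_cast h0.ne'
    funext i
    simp only [toC, hu, Pi.smul_apply, smul_eq_mul, Complex.ofReal_mul, Complex.ofReal_inv]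
    field_simp
  have hβv : toC y = (β : ℂ) • toC v := by
    rcases hβ0.eq_or_lt with h | h
    · rw [hy0 h.symm, ← h]; funext i; simp [toC]
    · have : (β : ℂ) ≠ 0 := by exact_mod_cast h.ne'
      funext i
      simp only [toC, hv, Pi.smul_apply, smul_eq_mul, Complex.ofReal_mul, Complex.ofReal_inv]
      field_simp
  -- for `s = η²` with `|η| = 1` this is `η (η.re u + η.im v)`
  set g : ℂ → (Fin m → ℂ) := fun s =>
    ((s + 1) / 2) • toC u + ((s - 1) / (2 * Complex.I)) • toC v with hg
  have hgd : Differentiable ℂ (fun s => f (g s)) := hf.comp (by rw [hg]; fun_prop)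
  have hcirc : ∀ s : ℂ, ‖s‖ = 1 → ‖f (g s)‖ ≤ M := by
    intro s hs1
    obtain ⟨η, hη⟩ := IsAlgClosed.exists_pow_nat_eq s two_pos
    have hη1 : ‖η‖ = 1 := by
      have := congrArg norm hη
      rw [norm_pow, hs1] at this
      exact (pow_eq_one_iff_of_nonneg (norm_nonneg _) two_ne_zero).1 this
    have hn : η.re ^ 2 + η.im ^ 2 = 1 := by
      have := Complex.normSq_apply η
      rw [Complex.normSq_eq_norm_sq, hη1] at this
      nlinarith
    have hη' : η = η.re + η.im * Complex.I := (Complex.re_add_im η).symm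
    have hc : η * (η.re - η.im * Complex.I) = 1 := by
      have : ((η.re : ℂ) ^ 2 + (η.im : ℂ) ^ 2) = 1 := by exact_mod_cast hn
      linear_combination ((η.re : ℂ) - η.im * Complex.I) * hη' + this -
        (η.im : ℂ) ^ 2 * Complex.I_sq
    have hgs : g s = η • toC (η.re • u + η.im • v) := by
      funext i
      simp only [hg, Pi.add_apply, Pi.smul_apply, smul_eq_mul, toC, Complex.ofReal_add,
        Complex.ofReal_mul]
      have h1 : (s + 1) / 2 = η * η.re := by
        rw [← hη]
        linear_combination (-1 / 2) * hc + (η / 2) * hη'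
      have h2 : (s - 1) / (2 * Complex.I) = η * η.im := by
        rw [← hη, div_eq_iff (by simp)]
        linear_combination hc + η * hη'
      rw [h1, h2]; ring
    rw [hgs, hom, norm_smul, norm_pow, hη1, one_pow, one_mul]
    refine (hreal _).trans ?_
    refine mul_le_of_le_one_left hM0 (pow_le_one₀ (Real.sqrt_nonneg _) ?_)
    refine Real.sqrt_le_one.2 ?_
    have : ∑ i, (η.re • u + η.im • v) i ^ 2 =
        η.re ^ 2 * ∑ i, u i ^ 2 + η.im ^ 2 * ∑ i, v i ^ 2 +
          2 * η.re * η.im * ∑ i, u i * v i := by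
      simp only [Finset.mul_sum, ← Finset.sum_add_distrib]
      exact Finset.sum_congr rfl fun i _ => by
        simp only [Pi.add_apply, Pi.smul_apply, smul_eq_mul]; ring
    rw [this, huv, hu1]
    nlinarith [sq_nonneg η.im]
  -- `g` takes the value `(x + iy) / (α + β)` at `ρ = (α - β) / (α + β)`
  set ρ : ℂ := (((α - β) / (α + β) : ℝ) : ℂ) with hρ
  have hsc : ((α : ℂ) + β) ≠ 0 := by exact_mod_cast hs.ne'
  have hwg : w = ((α + β : ℝ) : ℂ) • g ρ := by
    rw [hw, hαu, hβv]
    funext i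
    simp only [hg, hρ, Pi.add_apply, Pi.smul_apply, smul_eq_mul, Complex.ofReal_add,
      Complex.ofReal_div, Complex.ofReal_sub]
    have hI := Complex.I_ne_zero
    have h1 : (((α : ℂ) - β) / (α + β) + 1) / 2 = α / (α + β) := by field_simp; ring
    have h2 : (((α : ℂ) - β) / (α + β) - 1) / (2 * Complex.I) = Complex.I * β / (α + β) := by
      rw [div_eq_div_iff (by simp) hsc]
      field_simp
      linear_combination (-2 * (β : ℂ)) * Complex.I_sq
    rw [h1, h2]
    field_simp
  have hmem : ρ ∈ closure (Metric.ball (0 : ℂ) 1) := by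
    rw [closure_ball _ one_ne_zero, mem_closedBall_zero_iff, hρ, Complex.norm_real,
      Real.norm_of_nonneg (div_nonneg (by linarith) hs.le), div_le_one hs]
    linarith
  have hmax : ‖f (g ρ)‖ ≤ M :=
    Complex.norm_le_of_forall_mem_frontier_norm_le Metric.isBounded_ball hgd.diffContOnCl
      (fun s hs1 => hcirc s (by
        rw [frontier_ball _ one_ne_zero] at hs1; simpa using hs1)) hmem
  rw [hwg, hom, norm_smul, norm_pow, Complex.norm_real, Real.norm_of_nonneg hs.le]
  exact mul_le_mul_of_nonneg_left hmax (by positivity)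

lemma lieNorm_toC_add_smul_single_le {m : ℕ} {x : Fin m → ℝ} (hx : x ∈ unitSphere m) (i : Fin m)
    (t : ℂ) : lieNorm (toC x + t • (Pi.single i 1 : Fin m → ℂ)) ≤ 1 + 2 * ‖t‖ := by
  have hx' : ∑ i, x i ^ 2 = 1 := hx
  have hxi : x i ^ 2 ≤ 1 := by
    rw [← hx']
    exact Finset.single_le_sum (f := fun i => x i ^ 2) (fun _ _ => sq_nonneg _) (Finset.mem_univ i)
  have hxa : |x i| ≤ 1 := by rwa [← sq_le_one_iff_abs_le_one]
  have hre : ∑ j, ((toC x + t • (Pi.single i 1 : Fin m → ℂ)) j).re ^ 2 =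
      1 + 2 * x i * t.re + t.re ^ 2 := by
    have : ∀ j, ((toC x + t • (Pi.single i 1 : Fin m → ℂ)) j).re ^ 2 =
        x j ^ 2 + if j = i then 2 * x i * t.re + t.re ^ 2 else 0 := by
      intro j
      by_cases h : j = i
      · subst h; simp [toC]; ring
      · simp [toC, h]
    simp only [this, Finset.sum_add_distrib, hx']
    simp; ring
  have him : ∑ j, ((toC x + t • (Pi.single i 1 : Fin m → ℂ)) j).im ^ 2 = t.im ^ 2 := by
    have : ∀ j, ((toC x + t • (Pi.single i 1 : Fin m → ℂ)) j).im ^ 2 =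
        if j = i then t.im ^ 2 else 0 := by
      intro j
      by_cases h : j = i
      · subst h; simp [toC]
      · simp [toC, h]
    rw [Finset.sum_congr rfl fun j _ => this j]
    simp
  have h1 := Complex.abs_re_le_norm t
  have h2 := Complex.abs_im_le_norm t
  have hre' : ∑ j, ((toC x + t • (Pi.single i 1 : Fin m → ℂ)) j).re ^ 2 ≤ (1 + |t.re|) ^ 2 := by
    rw [hre]
    have : x i * t.re ≤ |t.re| := by
      calc x i * t.re ≤ |x i * t.re| := le_abs_self _
        _ = |x i| * |t.re| := abs_mul _ _
        _ ≤ 1 * |t.re| := by gcongr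
        _ = |t.re| := one_mul _
    nlinarith [sq_abs t.re]
  refine Real.sqrt_le_iff.2 ⟨by positivity, ?_⟩
  rw [lieNormSq_eq]
  have hsq : Real.sqrt ((∑ j, ((toC x + t • (Pi.single i 1 : Fin m → ℂ)) j).re ^ 2) *
      (∑ j, ((toC x + t • (Pi.single i 1 : Fin m → ℂ)) j).im ^ 2) -
      (∑ j, ((toC x + t • (Pi.single i 1 : Fin m → ℂ)) j).re *
        ((toC x + t • (Pi.single i 1 : Fin m → ℂ)) j).im) ^ 2) ≤
      (1 + |t.re|) * |t.im| := by
    refine Real.sqrt_le_iff.2 ⟨by positivity, ?_⟩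
    rw [him, mul_pow, sq_abs]
    nlinarith [sq_nonneg (∑ j, ((toC x + t • (Pi.single i 1 : Fin m → ℂ)) j).re *
      ((toC x + t • (Pi.single i 1 : Fin m → ℂ)) j).im),
      mul_le_mul_of_nonneg_right hre' (sq_nonneg t.im)]
  rw [him, ← sq_abs t.im] at hsq ⊢
  calc _ ≤ (1 + |t.re|) ^ 2 + |t.im| ^ 2 + 2 * ((1 + |t.re|) * |t.im|) := by gcongr
    _ = (1 + (|t.re| + |t.im|)) ^ 2 := by ring
    _ ≤ (1 + 2 * ‖t‖) ^ 2 := by gcongr; linarith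

/-- A Bernstein inequality, by Cauchy's estimate on a disc of radius `1 / (k + 1)` about a real
point. On that disc the Lie norm is at most `1 + 2 / (k + 1)`, whose `(k + 1)`-st power is at most
`e²`. -/
theorem norm_fderiv_single_le_of_homogeneous {m k : ℕ} (hm : 0 < m) {f : (Fin m → ℂ) → ℂ}
    (hf : Differentiable ℂ f) (hom : ∀ (t : ℂ) z, f (t • z) = t ^ (k + 1) • f z) {M : ℝ}
    (hM : ∀ x ∈ unitSphere m, ‖f (toC x)‖ ≤ M) {x : Fin m → ℝ} (hx : x ∈ unitSphere m)
    (i : Fin m) : ‖fderiv ℂ f (toC x) (Pi.single i 1)‖ ≤ Real.exp 2 * (k + 1) * M := by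
  have hM0 : 0 ≤ M := (norm_nonneg _).trans (hM x hx)
  have hk : (0 : ℝ) < k + 1 := by positivity
  have hline : HasDerivAt (fun t : ℂ => f (toC x + t • (Pi.single i 1 : Fin m → ℂ)))
      (fderiv ℂ f (toC x) (Pi.single i 1)) 0 := by
    have := (hf (toC x)).hasFDerivAt.hasLineDerivAt (Pi.single i (1 : ℂ))
    exact this
  rw [← hline.deriv]
  have := Complex.norm_deriv_le_of_forall_mem_sphere_norm_le (c := 0) (R := 1 / (k + 1))
    (C := Real.exp 2 * M) (f := fun t : ℂ => f (toC x + t • (Pi.single i 1 : Fin m → ℂ)))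
    (by positivity)
    (Differentiable.diffContOnCl (hf.comp (by fun_prop))) (fun t ht => by
      have ht' : ‖t‖ = 1 / (k + 1) := by simpa using ht
      refine (norm_le_lieNorm_pow_mul hm hf hom hM _).trans ?_
      refine mul_le_mul_of_nonneg_right ?_ hM0
      have h1 := lieNorm_toC_add_smul_single_le hx i t
      calc _ ≤ (1 + 2 * ‖t‖) ^ (k + 1) := pow_le_pow_left₀ (lieNorm_nonneg _) h1 _
        _ ≤ (Real.exp (2 * ‖t‖)) ^ (k + 1) := by
            gcongr; rw [add_comm]; exact Real.add_one_le_exp _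
        _ = Real.exp 2 := by
            rw [← Real.exp_nat_mul, ht']; congr 1; push_cast; field_simp)
  calc _ ≤ _ := this
    _ = _ := by field_simp

end LieBallCR

namespace LieBallCR

open Finset

/-! ### Gegenbauer polynomials -/

/-- The Pochhammer symbol `(x)_l = x (x + 1) ⋯ (x + l - 1)`. -/
noncomputable def poch (x : ℝ) (l : ℕ) : ℝ := (ascPochhammer ℝ l).eval x

/-- The Taylor coefficients `(x)_l / l!` of `(1 - r)^{-x}`. -/
noncomputable def negBinom (x : ℝ) (l : ℕ) : ℝ := poch x l / l.factorial

/-- The coefficient of `p^a c^j` in the Taylor coefficient of `r^{2j+a}` of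
`(1 - 2 p r + c r²)^{-x}`. -/
noncomputable def gegCoeff (x : ℝ) (j a : ℕ) : ℝ :=
  (-1) ^ j * 2 ^ a * poch x (j + a) / (j.factorial * a.factorial)

/-- The Gegenbauer polynomial `C_k^x`, homogenized: the Taylor coefficient of `r^k` of
`(1 - 2 p r + c r²)^{-x}`, so that `C_k^x(t)` is the value at `p = t`, `c = 1`. -/
noncomputable def geg (x : ℝ) (k : ℕ) (p c : ℂ) : ℂ :=
  ∑ j ∈ range (k / 2 + 1), (gegCoeff x j (k - 2 * j) : ℂ) * p ^ (k - 2 * j) * c ^ j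

lemma poch_zero (x : ℝ) : poch x 0 = 1 := by simp [poch]

lemma poch_succ (x : ℝ) (l : ℕ) : poch x (l + 1) = poch x l * (x + l) :=
  ascPochhammer_succ_eval l x

lemma poch_pos {x : ℝ} (hx : 0 < x) (l : ℕ) : 0 < poch x l := ascPochhammer_pos l x hx

lemma negBinom_zero (x : ℝ) : negBinom x 0 = 1 := by simp [negBinom, poch_zero]

lemma negBinom_pos {x : ℝ} (hx : 0 < x) (l : ℕ) : 0 < negBinom x l :=
  div_pos (poch_pos hx l) (by positivity)

lemma negBinom_succ (x : ℝ) (l : ℕ) :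
    (l + 1) * negBinom x (l + 1) = (x + l) * negBinom x l := by
  rw [negBinom, negBinom, poch_succ, Nat.factorial_succ]
  push_cast
  have : (l.factorial : ℝ) ≠ 0 := by positivity
  field_simp

lemma gegCoeff_succ_left (x : ℝ) (j a : ℕ) :
    gegCoeff x (j + 1) a * (4 * (j + 1) * (x + j + a + 1)) =
      -(gegCoeff x j (a + 2) * ((a + 2) * (a + 1))) := by
  rw [gegCoeff, gegCoeff, show j + (a + 2) = (j + 1 + a) + 1 by ring, poch_succ,
    Nat.factorial_succ, Nat.factorial_succ (a + 1), Nat.factorial_succ a]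
  have : (j.factorial : ℝ) ≠ 0 := by positivity
  have : (a.factorial : ℝ) ≠ 0 := by positivity
  push_cast
  field_simp
  ring

/-- The `j`-th term of `geg`, extended by zero to all `j`. -/
noncomputable def gegTerm (x : ℝ) (p c : ℂ) (k j : ℕ) : ℂ :=
  if 2 * j ≤ k then (gegCoeff x j (k - 2 * j) : ℂ) * p ^ (k - 2 * j) * c ^ j else 0

lemma geg_eq_sum_gegTerm (x : ℝ) (p c : ℂ) {k K : ℕ} (h : k < 2 * K) :
    geg x k p c = ∑ j ∈ range K, gegTerm x p c k j := by
  rw [← sum_subset (s₁ := range (k / 2 + 1))]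
  · refine sum_congr rfl fun j hj => ?_
    rw [mem_range] at hj
    rw [gegTerm, if_pos (by omega)]
  · intro j hj; rw [mem_range] at *; omega
  · intro j _ hj
    rw [mem_range] at hj
    rw [gegTerm, if_neg (by omega)]

lemma gegTerm_zero_rec (x : ℝ) (p c : ℂ) (k : ℕ) :
    ((k : ℂ) + 2) * gegTerm x p c (k + 2) 0 =
      2 * (k + 1 + x) * p * gegTerm x p c (k + 1) 0 := by
  simp only [gegTerm, mul_zero, zero_le, if_true, Nat.sub_zero, gegCoeff, zero_add, pow_zero]
  rw [poch_succ x (k + 1), Nat.factorial_succ (k + 1)]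
  have h2 : (((k + 1).factorial : ℕ) : ℂ) ≠ 0 := by exact_mod_cast (k + 1).factorial_ne_zero
  have h3 : (k : ℂ) + 2 ≠ 0 := by exact_mod_cast (k + 1).succ_ne_zero
  have h4 : (k : ℂ) + 1 + 1 ≠ 0 := by rwa [add_assoc, one_add_one_eq_two]
  push_cast
  field_simp
  ring

lemma gegTerm_succ_rec (x : ℝ) (p c : ℂ) (k j : ℕ) :
    ((k : ℂ) + 2) * gegTerm x p c (k + 2) (j + 1) =
      2 * (k + 1 + x) * p * gegTerm x p c (k + 1) (j + 1) -
        (k + 2 * x) * c * gegTerm x p c k j := by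
  have hj0 : ((j.factorial : ℕ) : ℂ) ≠ 0 := by exact_mod_cast j.factorial_ne_zero
  have hj1 : (j : ℂ) + 1 ≠ 0 := by exact_mod_cast j.succ_ne_zero
  rcases lt_trichotomy k (2 * j) with h | h | h
  · rw [gegTerm, gegTerm, gegTerm, if_neg (by omega), if_neg (by omega), if_neg (by omega)]; ring
  · subst h
    rw [gegTerm, gegTerm, gegTerm, if_pos (by omega), if_neg (by omega), if_pos (by omega)]
    rw [show 2 * j + 2 - 2 * (j + 1) = 0 by omega, Nat.sub_self]
    simp only [gegCoeff, add_zero, poch_succ x j, Nat.factorial_succ j]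
    push_cast
    field_simp
    ring
  · obtain ⟨b, rfl⟩ : ∃ b, k = 2 * j + 1 + b := ⟨k - 2 * j - 1, by omega⟩
    rw [gegTerm, gegTerm, gegTerm, if_pos (by omega), if_pos (by omega), if_pos (by omega)]
    rw [show 2 * j + 1 + b + 2 - 2 * (j + 1) = b + 1 by omega,
      show 2 * j + 1 + b + 1 - 2 * (j + 1) = b by omega,
      show 2 * j + 1 + b - 2 * j = b + 1 by omega]
    rw [gegCoeff, gegCoeff, gegCoeff, show j + 1 + (b + 1) = j + 1 + b + 1 by ring,
      show j + (b + 1) = j + 1 + b by ring, poch_succ x (j + 1 + b), Nat.factorial_succ j,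
      Nat.factorial_succ b]
    have hb0 : ((b.factorial : ℕ) : ℂ) ≠ 0 := by exact_mod_cast b.factorial_ne_zero
    have hb1 : (b : ℂ) + 1 ≠ 0 := by exact_mod_cast b.succ_ne_zero
    push_cast
    field_simp
    ring

/-- The three-term recurrence of the Gegenbauer polynomials. -/
lemma geg_rec (x : ℝ) (p c : ℂ) (k : ℕ) :
    ((k : ℂ) + 2) * geg x (k + 2) p c =
      2 * (k + 1 + x) * p * geg x (k + 1) p c - (k + 2 * x) * c * geg x k p c := by
  rw [geg_eq_sum_gegTerm x p c (show k + 2 < 2 * (k + 1 + 1) by omega),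
    geg_eq_sum_gegTerm x p c (show k + 1 < 2 * (k + 1 + 1) by omega),
    geg_eq_sum_gegTerm x p c (show k < 2 * (k + 1) by omega),
    sum_range_succ', sum_range_succ' (gegTerm x p c (k + 1)), mul_add, mul_add,
    gegTerm_zero_rec, mul_sum, mul_sum, mul_sum]
  simp only [gegTerm_succ_rec, sum_sub_distrib]
  ring

lemma geg_zero (x : ℝ) (p c : ℂ) : geg x 0 p c = 1 := by
  simp [geg, gegCoeff, poch_zero]

lemma geg_one (x : ℝ) (p c : ℂ) : geg x 1 p c = 2 * x * p := by
  simp [geg, gegCoeff, poch_succ, poch_zero]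

/-- The Cauchy product of the binomial series of `(1 - A r)^{-x}` and `(1 - B r)^{-x}`. -/
noncomputable def negBinomConv (x : ℝ) (A B : ℂ) (k : ℕ) : ℂ :=
  ∑ il ∈ antidiagonal k,
    ((negBinom x il.1 : ℂ) * A ^ il.1) * ((negBinom x il.2 : ℂ) * B ^ il.2)

open PowerSeries in
/-- The differential equation `(1 - A r) g' = x A g` of `g = (1 - A r)^{-x}`, for formal series. -/
lemma negBinom_series_ode (x : ℝ) (A : ℂ) :
    (1 - C A * X) * derivative ℂ (PowerSeries.mk fun l => (negBinom x l : ℂ) * A ^ l) =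
      C (x * A) * PowerSeries.mk fun l => (negBinom x l : ℂ) * A ^ l := by
  have hrec : ∀ l : ℕ, ((l : ℂ) + 1) * negBinom x (l + 1) = (x + l) * negBinom x l := fun l => by
    exact_mod_cast negBinom_succ x l
  ext l
  rw [sub_mul, one_mul, mul_assoc, map_sub, coeff_C_mul, coeff_C_mul, coeff_derivative, coeff_mk,
    coeff_mk]
  cases l with
  | zero =>
    have := hrec 0
    simp only [coeff_zero_X_mul]
    push_cast at *
    linear_combination A * this
  | succ l =>
    rw [coeff_succ_X_mul, coeff_derivative, coeff_mk]
    have := hrec (l + 1)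
    push_cast at *
    linear_combination A ^ (l + 2) * this

open PowerSeries in
lemma negBinomConv_rec (x : ℝ) (A B : ℂ) (k : ℕ) :
    ((k : ℂ) + 2) * negBinomConv x A B (k + 2) =
      (k + 1 + x) * (A + B) * negBinomConv x A B (k + 1) -
        (k + 2 * x) * (A * B) * negBinomConv x A B k := by
  set g := PowerSeries.mk fun l => (negBinom x l : ℂ) * A ^ l with hg
  set h := PowerSeries.mk fun l => (negBinom x l : ℂ) * B ^ l with hh
  have hco : ∀ k, negBinomConv x A B k = coeff k (g * h) := fun k => by
    rw [coeff_mul]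
    simp only [hg, hh, coeff_mk]
    rfl
  have h1 := negBinom_series_ode x A
  have h2 := negBinom_series_ode x B
  rw [← hg] at h1
  rw [← hh] at h2
  have h3 : derivative ℂ (g * h) - C (A + B) * (X * derivative ℂ (g * h)) +
      C (A * B) * (X * (X * derivative ℂ (g * h))) =
      C (x * (A + B)) * (g * h) - C (2 * x * (A * B)) * (X * (g * h)) := by
    rw [Derivation.leibniz]
    simp only [map_mul, map_add, smul_eq_mul, map_ofNat] at *
    linear_combination h * (1 - C B * X) * h1 + g * (1 - C A * X) * h2
  generalize A + B = S at h3 ⊢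
  generalize A * B = P at h3 ⊢
  have h4 := congrArg (coeff (k + 1)) h3
  simp only [map_sub, map_add, coeff_C_mul, coeff_succ_X_mul, coeff_derivative, ← hco] at h4
  cases k with
  | zero =>
    simp only [coeff_zero_X_mul] at h4
    push_cast at *
    linear_combination h4
  | succ k =>
    simp only [coeff_succ_X_mul, coeff_derivative, ← hco] at h4
    push_cast at *
    linear_combination h4

lemma negBinomConv_zero (x : ℝ) (A B : ℂ) : negBinomConv x A B 0 = 1 := by
  simp [negBinomConv, negBinom_zero]

lemma negBinomConv_one (x : ℝ) (A B : ℂ) : negBinomConv x A B 1 = x * (A + B) := by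
  have h := negBinom_succ x 0
  simp only [negBinom_zero, Nat.cast_zero, zero_add, add_zero, mul_one, one_mul] at h
  have : antidiagonal 1 = {(0, 1), (1, 0)} := rfl
  rw [negBinomConv, this, sum_pair (by simp)]
  simp [negBinom_zero, h]
  ring

/-- If `1 - 2 p r + c r² = (1 - A r) (1 - B r)`, the Gegenbauer polynomial is a Cauchy product of
binomial series. -/
lemma geg_eq_negBinomConv (x : ℝ) {p c A B : ℂ} (h1 : A + B = 2 * p) (h2 : A * B = c) (k : ℕ) :
    geg x k p c = negBinomConv x A B k := by
  induction k using Nat.twoStepInduction with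
  | zero => rw [geg_zero, negBinomConv_zero]
  | one => rw [geg_one, negBinomConv_one, h1]; ring
  | more k ih1 ih2 =>
    have e1 := geg_rec x p c k
    have e2 := negBinomConv_rec x A B k
    have h3 : (k : ℂ) + 2 ≠ 0 := by exact_mod_cast (k + 1).succ_ne_zero
    apply mul_left_cancel₀ h3
    rw [e1, e2, ih1, ih2, h1, h2]; ring

/-- `(1 - r)^{-x} (1 - r)^{-x} = (1 - r)^{-2x}`, coefficientwise. -/
lemma negBinomConv_one_one (x : ℝ) (k : ℕ) : negBinomConv x 1 1 k = negBinom (2 * x) k := by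
  induction k using Nat.twoStepInduction with
  | zero => rw [negBinomConv_zero, negBinom_zero, Complex.ofReal_one]
  | one =>
    rw [negBinomConv_one]
    have h := negBinom_succ (2 * x) 0
    simp only [negBinom_zero, Nat.cast_zero, zero_add, add_zero, mul_one, one_mul] at h
    rw [h]; push_cast; ring
  | more k ih1 ih2 =>
    have e2 := negBinomConv_rec x 1 1 k
    have h3 : (k : ℂ) + 2 ≠ 0 := by exact_mod_cast (k + 1).succ_ne_zero
    apply mul_left_cancel₀ h3
    rw [e2, ih1, ih2]
    have f1 : ((k : ℂ) + 1) * negBinom (2 * x) (k + 1) = (2 * x + k) * negBinom (2 * x) k := by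
      exact_mod_cast negBinom_succ (2 * x) k
    have f2 : ((k : ℂ) + 1 + 1) * negBinom (2 * x) (k + 1 + 1) =
        (2 * x + (k + 1)) * negBinom (2 * x) (k + 1) := by
      exact_mod_cast negBinom_succ (2 * x) (k + 1)
    linear_combination f1 - f2

/-- Gegenbauer polynomials of positive index are bounded by their value at `1`: in
`C_k(cos φ) = ∑ a_i a_l e^{i (i - l) φ}` all coefficients are positive. -/
lemma norm_geg_le {x : ℝ} (hx : 0 < x) (k : ℕ) {p c : ℝ} (h1 : p ^ 2 ≤ c) (h2 : c ≤ 1) :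
    ‖geg x k p c‖ ≤ negBinom (2 * x) k := by
  set s := Real.sqrt (c - p ^ 2) with hs
  have hs2 : s ^ 2 = c - p ^ 2 := Real.sq_sqrt (by linarith)
  have hs2' : (s : ℂ) ^ 2 = c - p ^ 2 := by exact_mod_cast hs2
  rw [geg_eq_negBinomConv x (A := p + s * Complex.I) (B := p - s * Complex.I) (by ring)
    (by linear_combination hs2' - (s : ℂ) ^ 2 * Complex.I_sq)]
  have hA : ‖(p : ℂ) + s * Complex.I‖ ≤ 1 := by
    rw [← sq_le_one_iff₀ (norm_nonneg _), ← Complex.normSq_eq_norm_sq, Complex.normSq_apply]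
    simp; nlinarith
  have hB : ‖(p : ℂ) - s * Complex.I‖ ≤ 1 := by
    rw [← sq_le_one_iff₀ (norm_nonneg _), ← Complex.normSq_eq_norm_sq, Complex.normSq_apply]
    simp; nlinarith
  have h : ((negBinom (2 * x) k : ℝ) : ℂ) =
      ((∑ il ∈ antidiagonal k, negBinom x il.1 * negBinom x il.2 : ℝ) : ℂ) := by
    rw [← negBinomConv_one_one, negBinomConv]
    push_cast
    simp
  rw [Complex.ofReal_inj.1 h]
  refine (norm_sum_le _ _).trans (sum_le_sum fun il _ => ?_)
  rw [norm_mul, norm_mul, norm_mul, norm_pow, norm_pow, Complex.norm_real, Complex.norm_real,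
    Real.norm_of_nonneg (negBinom_pos hx _).le, Real.norm_of_nonneg (negBinom_pos hx _).le]
  have p1 := (negBinom_pos hx il.1).le
  have p2 := (negBinom_pos hx il.2).le
  calc _ ≤ (negBinom x il.1 * 1) * (negBinom x il.2 * 1) := by
        gcongr
        · exact pow_le_one₀ (norm_nonneg _) hA
        · exact pow_le_one₀ (norm_nonneg _) hB
    _ = _ := by ring

lemma geg_mul_sq (x : ℝ) (k : ℕ) (s p c : ℂ) :
    geg x k (s * p) (s ^ 2 * c) = s ^ k * geg x k p c := by
  rw [geg, geg, mul_sum]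
  refine sum_congr rfl fun j hj => ?_
  rw [mem_range] at hj
  have : s ^ k = s ^ (k - 2 * j) * (s ^ 2) ^ j := by rw [← pow_mul, ← pow_add]; congr 1; omega
  rw [this, mul_pow, mul_pow]; ring

lemma exists_add_eq_mul_eq (p c : ℂ) : ∃ A B : ℂ, A + B = 2 * p ∧ A * B = c := by
  obtain ⟨s, hs⟩ := IsAlgClosed.exists_pow_nat_eq (p ^ 2 - c) two_pos
  exact ⟨p + s, p - s, by ring, by linear_combination -hs⟩

/-- The binomial series of `(1 - A)^{-x}`. -/
lemma hasSum_negBinom (x : ℝ) {A : ℂ} (hA : ‖A‖ < 1) :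
    HasSum (fun l => (negBinom x l : ℂ) * A ^ l) ((1 - A) ^ (-x : ℂ)) ∧
      Summable fun l => ‖(negBinom x l : ℂ) * A ^ l‖ := by
  have h := Complex.one_div_one_sub_cpow_hasFPowerSeriesOnBall_zero (x : ℂ)
  have hmem : A ∈ Metric.eball (0 : ℂ) 1 := by
    rw [Metric.mem_eball, edist_zero_right, ← ofReal_norm]
    exact ENNReal.ofReal_lt_one.2 hA
  have hc : ∀ l : ℕ, Ring.choose ((x : ℂ) + l - 1) l = negBinom x l := by
    intro l
    rw [← Ring.multichoose_eq, negBinom, poch]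
    have h1 := Ring.factorial_nsmul_multichoose_eq_ascPochhammer (x : ℂ) l
    rw [Polynomial.ascPochhammer_smeval_eq_eval, nsmul_eq_mul] at h1
    have h2 : ((Polynomial.eval x (ascPochhammer ℝ l) : ℝ) : ℂ) =
        Polynomial.eval (x : ℂ) (ascPochhammer ℂ l) := by
      rw [← ascPochhammer_map Complex.ofRealHom l, Polynomial.eval_map]
      exact (Polynomial.hom_eval₂ _ (RingHom.id ℝ) Complex.ofRealHom x).trans rfl
    push_cast
    rw [h2, ← h1]
    have : ((l.factorial : ℕ) : ℂ) ≠ 0 := by exact_mod_cast l.factorial_ne_zero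
    field_simp
  have hterm : ∀ l, (FormalMultilinearSeries.ofScalars ℂ
      fun n ↦ Ring.choose ((x : ℂ) + n - 1) n) l (fun _ => A) = (negBinom x l : ℂ) * A ^ l := by
    intro l
    rw [FormalMultilinearSeries.ofScalars_apply_eq, hc, smul_eq_mul]
  have h1 := h.hasSum hmem
  have h2 := FormalMultilinearSeries.summable_norm_apply _ (Metric.eball_subset_eball h.r_le hmem)
  simp only [hterm] at h1 h2
  rw [zero_add, one_div, ← Complex.cpow_neg] at h1
  exact ⟨h1, h2⟩

/-- Powers with complex exponents are multiplicative here, because `1 - A` and `1 - B` have positive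
real part and their arguments add up to less than `π` in absolute value. -/
lemma mul_cpow_one_sub {A B : ℂ} (hA : ‖A‖ < 1) (hB : ‖B‖ < 1) (s : ℂ) :
    ((1 - A) * (1 - B)) ^ s = (1 - A) ^ s * (1 - B) ^ s := by
  have key : ∀ A : ℂ, ‖A‖ < 1 → 1 - A ≠ 0 ∧ |(1 - A).arg| < Real.pi / 2 := by
    intro A hA
    have hre : 0 < (1 - A).re := by
      have := (Complex.abs_re_le_norm A).trans_lt hA
      simp only [Complex.sub_re, Complex.one_re]
      linarith [(abs_lt.1 this).2]
    exact ⟨fun h => by rw [h] at hre; simp at hre, Complex.abs_arg_lt_pi_div_two_iff.2 (.inl hre)⟩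
  obtain ⟨a0, a1⟩ := key A hA
  obtain ⟨b0, b1⟩ := key B hB
  rw [abs_lt] at a1 b1
  rw [Complex.cpow_def_of_ne_zero (mul_ne_zero a0 b0), Complex.cpow_def_of_ne_zero a0,
    Complex.cpow_def_of_ne_zero b0, ← Complex.exp_add,
    (Complex.log_mul_eq_add_log_iff a0 b0).2 ⟨by linarith, by linarith⟩, add_mul]

/-- The generating function of the Gegenbauer polynomials at `r = 1`. It converges if
`1 - 2 p r + c r² = (1 - A r) (1 - B r)` has its zeros outside the closed unit disc. -/
theorem hasSum_geg (x : ℝ) {p c A B : ℂ} (h1 : A + B = 2 * p) (h2 : A * B = c) (hA : ‖A‖ < 1)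
    (hB : ‖B‖ < 1) : HasSum (fun k => geg x k p c) ((1 - 2 * p + c) ^ (-x : ℂ)) := by
  obtain ⟨a1, a2⟩ := hasSum_negBinom x hA
  obtain ⟨b1, b2⟩ := hasSum_negBinom x hB
  have hs := (summable_norm_sum_mul_antidiagonal_of_summable_norm a2 b2).of_norm.hasSum
  rw [← tsum_mul_tsum_eq_tsum_sum_antidiagonal_of_summable_norm a2 b2, a1.tsum_eq, b1.tsum_eq,
    ← mul_cpow_one_sub hA hB] at hs
  rw [show 1 - 2 * p + c = (1 - A) * (1 - B) by rw [← h1, ← h2]; ring]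
  simpa only [geg_eq_negBinomConv x h1 h2, negBinomConv] using hs

/-- The Gegenbauer polynomials as Taylor coefficients of their generating function. -/
theorem iteratedDeriv_gegenbauer (x : ℝ) (k : ℕ) (t : ℂ) :
    iteratedDeriv k (fun r : ℂ => (1 - 2 * t * r + r ^ 2) ^ (-x : ℂ)) 0 / (k.factorial : ℂ) =
      geg x k t 1 := by
  obtain ⟨A, B, hAB, hAB'⟩ := exists_add_eq_mul_eq t 1
  have hfps : HasFPowerSeriesAt (fun r : ℂ => (1 - 2 * t * r + r ^ 2) ^ (-x : ℂ))
      (.ofScalars ℂ fun k => geg x k t 1) 0 := by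
    rw [hasFPowerSeriesAt_iff]
    have ev : ∀ D : ℂ, ∀ᶠ r : ℂ in nhds 0, ‖r * D‖ < 1 := fun D => by
      refine (Continuous.norm (by fun_prop)).continuousAt.eventually_lt continuousAt_const ?_
      simp
    filter_upwards [ev A, ev B] with r hA hB
    have := hasSum_geg x (p := r * t) (c := r ^ 2 * 1) (A := r * A) (B := r * B)
      (by linear_combination r * hAB) (by linear_combination r ^ 2 * hAB') hA hB
    simp only [geg_mul_sq] at this
    simp only [FormalMultilinearSeries.coeff_ofScalars, smul_eq_mul, zero_add]
    rwa [show 1 - 2 * t * r + r ^ 2 = 1 - 2 * (r * t) + r ^ 2 * 1 by ring]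
  have h := hfps.analyticAt.hasFPowerSeriesAt.eq_formalMultilinearSeries hfps
  have := congrArg (fun q => FormalMultilinearSeries.coeff q k) h
  simpa only [FormalMultilinearSeries.coeff_ofScalars] using this

/-- On the Lie ball the quadratic `1 - 2 p r + c r²` of the kernel has both its inverse roots in
the unit disc. -/
lemma norm_lt_one_of_mem_lieBall {m : ℕ} {ω : Fin m → ℝ} (hω : ω ∈ unitSphere m) {z : Fin m → ℂ}
    (hz : z ∈ lieBall m) {A B : ℂ} (h1 : A + B = 2 * bilin (toC ω) z) (h2 : A * B = bilin z z) :
    ‖A‖ < 1 := by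
  by_contra! hA
  have hA0 : A ≠ 0 := fun h => by rw [h, norm_zero] at hA; linarith
  have hq : bilin (toC ω - A⁻¹ • z) (toC ω - A⁻¹ • z) = 0 := by
    have e : bilin (toC ω - A⁻¹ • z) (toC ω - A⁻¹ • z) =
        bilin (toC ω) (toC ω) - 2 * A⁻¹ * bilin (toC ω) z + A⁻¹ ^ 2 * bilin z z := by
      simp only [bilin, Finset.mul_sum, ← Finset.sum_sub_distrib, ← Finset.sum_add_distrib]
      exact Finset.sum_congr rfl fun i _ => by
        simp only [Pi.sub_apply, Pi.smul_apply, smul_eq_mul]; ring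
    rw [e, bilin_toC_self hω, ← h2]
    field_simp
    linear_combination h1
  have h3 := one_le_lieNormSq_of_bilin_sub_eq_zero hω hq
  rw [lieNormSq_smul, norm_inv] at h3
  have h4 : lieNormSq z < 1 := hz
  have h5 : ‖A‖⁻¹ ^ 2 ≤ 1 := pow_le_one₀ (by positivity) (inv_le_one_of_one_le₀ hA)
  nlinarith [lieNormSq_nonneg z]

end LieBallCR

namespace LieBallCR

open Finset MvPolynomial

/-! ### Polynomial maps -/

/-- Formal and analytic partial derivatives agree. -/
lemma exists_hasFDerivAt_eval {m : ℕ} (p : MvPolynomial (Fin m) ℂ) (z : Fin m → ℂ) :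
    ∃ L : (Fin m → ℂ) →L[ℂ] ℂ, HasFDerivAt (fun z => eval z p) L z ∧
      ∀ i, L (Pi.single i 1) = eval z (pderiv i p) := by
  induction p using MvPolynomial.induction_on with
  | C a =>
    refine ⟨0, ?_, fun i => by simp⟩
    simp only [eval_C]
    exact hasFDerivAt_const a z
  | add p q hp hq =>
    obtain ⟨L, hL, hL'⟩ := hp
    obtain ⟨K, hK, hK'⟩ := hq
    refine ⟨L + K, ?_, fun i => by simp [hL', hK']⟩
    simp only [map_add]
    exact hL.add hK
  | mul_X p j hp =>
    obtain ⟨L, hL, hL'⟩ := hp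
    have hX : HasFDerivAt (fun z : Fin m → ℂ => z j)
        (ContinuousLinearMap.proj j : (Fin m → ℂ) →L[ℂ] ℂ) z :=
      (ContinuousLinearMap.proj j : (Fin m → ℂ) →L[ℂ] ℂ).hasFDerivAt
    refine ⟨_, (hL.mul hX).congr_of_eventuallyEq (.of_forall fun w => by simp), fun i => ?_⟩
    · simp only [add_apply, smul_apply, ContinuousLinearMap.proj_apply, smul_eq_mul, hL',
        pderiv_mul, eval_add, eval_mul, eval_X, pderiv_X, Pi.single_apply]
      by_cases h : j = i
      · subst h; simp; ring
      · simp [h]; ring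

lemma fderiv_eval_single {m : ℕ} (p : MvPolynomial (Fin m) ℂ) (z : Fin m → ℂ) (i : Fin m) :
    fderiv ℂ (fun z => eval z p) z (Pi.single i 1) = eval z (pderiv i p) := by
  obtain ⟨L, h, h'⟩ := exists_hasFDerivAt_eval p z
  rw [h.fderiv, h']

lemma contDiff_eval {m : ℕ} (p : MvPolynomial (Fin m) ℂ) :
    ContDiff ℂ 1 (fun z : Fin m → ℂ => eval z p) :=
  (AnalyticOnNhd.eval_mvPolynomial p).contDiff

lemma eval_smul_of_isHomogeneous {m k : ℕ} {p : MvPolynomial (Fin m) ℂ} (hp : p.IsHomogeneous k)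
    (t : ℂ) (z : Fin m → ℂ) : eval (t • z) p = t ^ k * eval z p := by
  rw [eval_eq', eval_eq', mul_sum]
  refine sum_congr rfl fun d hd => ?_
  have hdeg : ∑ i, d i = k := by
    rw [← Finsupp.degree_eq_sum]; exact (hp.degree_eq_sum_deg_support hd).symm
  simp only [Pi.smul_apply, smul_eq_mul, mul_pow, prod_mul_distrib, prod_pow_eq_pow_sum, hdeg]
  ring

lemma pderiv_comm {m : ℕ} (i j : Fin m) (p : MvPolynomial (Fin m) ℂ) :
    pderiv i (pderiv j p) = pderiv j (pderiv i p) := by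
  let D : Fin m → Derivation ℂ (MvPolynomial (Fin m) ℂ) (MvPolynomial (Fin m) ℂ) :=
    fun i => pderiv i
  have h : ⁅D i, D j⁆ = 0 := by
    refine derivation_ext (R := ℂ) fun k => ?_
    rw [Derivation.commutator_apply]
    simp [D, pderiv_X, Pi.single_apply, apply_ite]
  have h' := DFunLike.congr_fun h p
  rw [Derivation.commutator_apply] at h'
  exact sub_eq_zero.1 h'

/-- The map `(∂₀ V, -∂₁ V, …, -∂ₙ V)`, the conjugate gradient of a polynomial `V`. -/
noncomputable def conjGrad {n : ℕ} (V : MvPolynomial (Fin (n + 1)) ℂ) (z : Fin (n + 1) → ℂ) :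
    Fin (n + 1) → ℂ :=
  Fin.cons (eval z (pderiv 0 V)) fun i => -eval z (pderiv i.succ V)

/-- Each component of `conjGrad V` is a signed partial derivative of `V`. -/
lemma conjGrad_apply {n : ℕ} (V : MvPolynomial (Fin (n + 1)) ℂ) (z : Fin (n + 1) → ℂ)
    (j : Fin (n + 1)) :
    conjGrad V z j = eval z ((if j = 0 then 1 else -1) * pderiv j V) := by
  refine Fin.cases ?_ (fun i => ?_) j
  · simp [conjGrad]
  · simp [conjGrad, Fin.succ_ne_zero]

lemma contDiff_conjGrad {n : ℕ} (V : MvPolynomial (Fin (n + 1)) ℂ) :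
    ContDiff ℂ 1 (conjGrad V) := by
  rw [contDiff_pi]
  intro j
  simp only [conjGrad_apply]
  exact contDiff_eval _

/-- The conjugate gradient of a harmonic polynomial is left complex regular. -/
lemma leftComplexRegularOn_conjGrad {n : ℕ} {V : MvPolynomial (Fin (n + 1)) ℂ}
    (hV : ∑ i, pderiv i (pderiv i V) = 0) :
    LeftComplexRegularOn (conjGrad V) Set.univ := by
  refine ⟨(contDiff_conjGrad V).contDiffOn, fun z _ => ?_⟩
  have hf : ∀ i j, fderiv ℂ (conjGrad V) z (Pi.single i 1) j =
      (if j = 0 then 1 else -1) * eval z (pderiv i (pderiv j V)) := by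
    intro i j
    have h : fderiv ℂ (fun w => conjGrad V w j) z (Pi.single i 1) =
        fderiv ℂ (conjGrad V) z (Pi.single i 1) j := by
      rw [fderiv_apply ((contDiff_conjGrad V).differentiable one_ne_zero z)]
      rfl
    rw [← h]
    simp only [conjGrad_apply, fderiv_eval_single]
    by_cases hj : j = 0 <;> simp [hj]
  refine sum_smul_cliffE_mul_eq_zero ?_ ?_ ?_
  · have h := congrArg (eval z) hV
    rw [Fin.sum_univ_succ] at h
    simp only [map_add, map_sum, map_zero] at h
    simp only [hf, Fin.succ_ne_zero, if_true, if_false]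
    rw [← mul_sum]
    linear_combination h
  · intro j
    simp only [hf, Fin.succ_ne_zero, if_true, if_false, pderiv_comm 0 j.succ]
    ring
  · intro i j
    simp only [hf, Fin.succ_ne_zero, if_false, pderiv_comm i.succ j.succ]

/-! ### The harmonic potential -/

section Potential

variable {n : ℕ}

/-- Polynomials in the variables `z₀, …, zₙ`. -/
abbrev Poly (n : ℕ) : Type := MvPolynomial (Fin (n + 1)) ℂ

/-- The linear form `⟨σ, z'⟩` in the variables `z = (z₀, z')`. -/
noncomputable def linForm (σ : Fin n → ℂ) : Poly n :=
  ∑ i : Fin n, C (σ i) * X i.succ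

/-- The quadratic form `⟨z', z'⟩` in the variables `z = (z₀, z')`. -/
noncomputable def sqForm (n : ℕ) : Poly n :=
  ∑ i : Fin n, X i.succ ^ 2

/-- The polynomial `∫_0^{z₀} (z₀² + ⟨z', z'⟩ - y²)^j dy`, through the recursion that integration
by parts yields. -/
noncomputable def primT (n : ℕ) : ℕ → Poly n
  | 0 => X 0
  | j + 1 => C ((2 * (j : ℂ) + 3)⁻¹) *
      (2 * ((j : Poly n) + 1) * (sqForm n + X 0 ^ 2) * primT n j +
        X 0 * sqForm n ^ (j + 1))

lemma primT_zero : primT n 0 = X 0 := rfl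

lemma primT_succ (j : ℕ) :
    (2 * (j : Poly n) + 3) * primT n (j + 1) =
      2 * ((j : Poly n) + 1) * (sqForm n + X 0 ^ 2) * primT n j +
        X 0 * sqForm n ^ (j + 1) := by
  have h : (2 * (j : ℂ) + 3) ≠ 0 := by exact_mod_cast (2 * j + 2).succ_ne_zero
  have hC : (2 * (j : Poly n) + 3) * C ((2 * (j : ℂ) + 3)⁻¹) = 1 := by
    rw [show (2 * (j : Poly n) + 3) = C (2 * (j : ℂ) + 3) by
        simp only [map_add, map_mul, map_natCast, map_ofNat], ← C_mul,
      mul_inv_cancel₀ h, C_1]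
  rw [primT, ← mul_assoc, hC, one_mul]

lemma natCast_two_mul_add_three_ne_zero (j : ℕ) :
    (2 * (j : Poly n) + 3) ≠ 0 := by
  exact_mod_cast (2 * j + 2).succ_ne_zero

lemma pderiv_zero_linForm (σ : Fin n → ℂ) : pderiv 0 (linForm σ) = 0 := by
  simp [linForm, pderiv_X, Fin.succ_ne_zero]

lemma pderiv_succ_linForm (σ : Fin n → ℂ) (i : Fin n) :
    pderiv i.succ (linForm σ) = C (σ i) := by
  simp only [linForm, map_sum, pderiv_C_mul, pderiv_X]
  rw [sum_eq_single i (fun j _ hj => by simp [hj]) (by simp)]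
  simp

lemma pderiv_zero_sqForm : pderiv 0 (sqForm n) = 0 := by
  simp [sqForm, pderiv_X, Fin.succ_ne_zero]

lemma pderiv_succ_sqForm (i : Fin n) : pderiv i.succ (sqForm n) = 2 * X i.succ := by
  simp only [sqForm, map_sum, pderiv_pow, pderiv_X]
  rw [sum_eq_single i (fun j _ hj => by simp [hj]) (by simp)]
  simp

lemma pderiv_natCast (i : Fin (n + 1)) (j : ℕ) :
    pderiv i (j : Poly n) = 0 := by
  rw [show (j : Poly n) = C (j : ℂ) by simp, pderiv_C]

lemma pderiv_ofNat (i : Fin (n + 1)) (j : ℕ) [j.AtLeastTwo] :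
    pderiv i (ofNat(j) : Poly n) = 0 := by
  rw [show (ofNat(j) : Poly n) = ((j : ℕ) : Poly n) from Nat.cast_ofNat.symm, pderiv_natCast]

lemma pderiv_zero_primT_succ (j : ℕ) :
    pderiv 0 (primT n (j + 1)) = sqForm n ^ (j + 1) + 2 * ((j + 1 : ℕ) : Poly n) * X 0 *
      primT n j := by
  induction j with
  | zero =>
    apply mul_left_cancel₀ (natCast_two_mul_add_three_ne_zero (n := n) 0)
    have h := congrArg (pderiv 0) (primT_succ (n := n) 0)
    have h1 := primT_succ (n := n) 0
    rw [primT_zero] at *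
    simp only [pderiv_mul, map_add, pderiv_pow, pderiv_zero_sqForm, pderiv_X_self,
      Nat.cast_zero, pderiv_one, map_zero, pderiv_ofNat] at h
    push_cast at *
    linear_combination h
  | succ j ih =>
    apply mul_left_cancel₀ (natCast_two_mul_add_three_ne_zero (n := n) (j + 1))
    have h := congrArg (pderiv 0) (primT_succ (n := n) (j + 1))
    have h1 := primT_succ (n := n) j
    simp only [pderiv_mul, map_add, pderiv_pow, pderiv_zero_sqForm, pderiv_X_self, pderiv_natCast,
      pderiv_one, ih, pderiv_ofNat] at h
    simp only [Nat.add_sub_cancel] at h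
    push_cast at *
    linear_combination h - 2 * ((j : Poly n) + 2) * X 0 * h1

lemma pderiv_zero_primT (j : ℕ) :
    pderiv 0 (primT n j) = sqForm n ^ j + 2 * (j : Poly n) * X 0 * primT n (j - 1) := by
  cases j with
  | zero => simp [primT_zero]
  | succ j => exact pderiv_zero_primT_succ j

lemma pderiv_succ_primT (i : Fin n) (j : ℕ) :
    pderiv i.succ (primT n j) = 2 * (j : Poly n) * X i.succ * primT n (j - 1) := by
  have h0 : pderiv i.succ (X 0 : Poly n) = 0 :=
    pderiv_X_of_ne (Fin.succ_ne_zero i).symm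
  induction j with
  | zero => simp [primT_zero, h0]
  | succ j ih =>
    apply mul_left_cancel₀ (natCast_two_mul_add_three_ne_zero (n := n) j)
    have h := congrArg (pderiv i.succ) (primT_succ (n := n) j)
    simp only [pderiv_mul, map_add, pderiv_pow, pderiv_succ_sqForm, h0, pderiv_natCast,
      pderiv_one, ih, pderiv_ofNat] at h
    simp only [Nat.add_sub_cancel] at h ⊢
    cases j with
    | zero =>
      rw [primT_zero] at *
      push_cast at *
      linear_combination h
    | succ j =>
      have h1 := primT_succ (n := n) j
      simp only [Nat.add_sub_cancel] at h
      push_cast at *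
      linear_combination h - 2 * ((j : Poly n) + 2) * X i.succ * h1

/-- The recursion for `primT`, in the form valid for all `j`. -/
lemma mul_primT_pred_pred (j : ℕ) :
    2 * (j : Poly n) * ((j - 1 : ℕ) : Poly n) *
        (sqForm n + X 0 ^ 2) * primT n (j - 1 - 1) =
      (j : Poly n) * ((2 * (j : Poly n) - 1) * primT n (j - 1) -
        X 0 * sqForm n ^ (j - 1)) := by
  match j with
  | 0 => simp
  | 1 => simp only [primT_zero, Nat.sub_self, pow_zero, Nat.cast_zero, Nat.cast_one]; ring
  | j + 2 =>
    have h := primT_succ (n := n) j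
    simp only [show j + 2 - 1 = j + 1 by omega, show j + 1 - 1 = j by omega]
    push_cast
    linear_combination (-((j : Poly n) + 2)) * h

/-- The Laplacian of `⟨σ, z'⟩^a ∫_0^{z₀} (z₀² + ⟨z', z'⟩ - y²)^j dy`. -/
lemma laplacian_linForm_pow_mul_primT (σ : Fin n → ℂ) (a j : ℕ) :
    ∑ i, pderiv i (pderiv i (linForm σ ^ a * primT n j)) =
      (a : Poly n) * ((a - 1 : ℕ) : Poly n) *
          C (bilin σ σ) * linForm σ ^ (a - 2) * primT n j +
        2 * (j : Poly n) * (2 * (a : Poly n) + 2 * (j : Poly n) + (n : Poly n)) * linForm σ ^ a *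
          primT n (j - 1) := by
  have h0 : ∀ i : Fin n, pderiv i.succ (X 0 : Poly n) = 0 :=
    fun i => pderiv_X_of_ne (Fin.succ_ne_zero i).symm
  have hz : pderiv 0 (pderiv 0 (linForm σ ^ a * primT n j)) = linForm σ ^ a *
      (2 * (j : Poly n) * primT n (j - 1) + 2 * (j : Poly n) * X 0 * (sqForm n ^ (j - 1) +
        2 * ((j - 1 : ℕ) : Poly n) * X 0 * primT n (j - 1 - 1))) := by
    simp only [pderiv_mul, pderiv_pow, pderiv_zero_linForm, pderiv_zero_primT, map_add,
      pderiv_natCast, pderiv_X_self, pderiv_zero_sqForm, pderiv_ofNat, map_zero]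
    ring
  have hs : ∀ i : Fin n, pderiv i.succ (pderiv i.succ (linForm σ ^ a * primT n j)) =
      (a : Poly n) * ((a - 1 : ℕ) : Poly n) * linForm σ ^ (a - 2) * primT n j *
          C (σ i * σ i) +
        (4 * (a : Poly n) * (j : Poly n) * linForm σ ^ (a - 1) * primT n (j - 1)) *
          (C (σ i) * X i.succ) +
        2 * (j : Poly n) * linForm σ ^ a * primT n (j - 1) +
        4 * (j : Poly n) * ((j - 1 : ℕ) : Poly n) * linForm σ ^ a *
          primT n (j - 1 - 1) * X i.succ ^ 2 := by
    intro i
    simp only [pderiv_mul, pderiv_pow, pderiv_succ_linForm, pderiv_succ_primT, map_add,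
      pderiv_natCast, pderiv_X_self, pderiv_ofNat, pderiv_C, C_mul,
      show a - 1 - 1 = a - 2 by omega]
    ring
  have hP : (a : Poly n) * linForm σ ^ (a - 1) * linForm σ =
      (a : Poly n) * linForm σ ^ a := by
    cases a with
    | zero => simp
    | succ a => rw [Nat.add_sub_cancel, pow_succ, mul_assoc]
  rw [Fin.sum_univ_succ, hz, sum_congr rfl fun i _ => hs i]
  simp only [sum_add_distrib, ← mul_sum, ← map_sum, sum_const, card_univ, Fintype.card_fin,
    nsmul_eq_mul]
  rw [show ∑ i : Fin n, C (σ i) * X i.succ = linForm σ from rfl,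
    show ∑ i : Fin n, (X i.succ : Poly n) ^ 2 = sqForm n from rfl,
    show ∑ i : Fin n, σ i * σ i = bilin σ σ from rfl]
  linear_combination (4 * (j : Poly n) * primT n (j - 1)) * hP +
    (2 * linForm σ ^ a) * mul_primT_pred_pred j

/-- The potential `∫_0^{z₀} C_k(⟨σ, z'⟩, ⟨σ, σ⟩ (⟨z, z⟩ - y²)) dy`, with `C_k` the homogenized
Gegenbauer polynomial of index `n / 2`. It is the harmonic polynomial in `z` that vanishes for
`z₀ = 0` and has there the normal derivative `C_k(⟨σ, z'⟩, ⟨σ, σ⟩ ⟨z', z'⟩)`. -/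
noncomputable def potential (k : ℕ) (σ : Fin n → ℂ) : Poly n :=
  ∑ j ∈ range (k / 2 + 1), C ((gegCoeff (n / 2) j (k - 2 * j) : ℂ) * bilin σ σ ^ j) *
    (linForm σ ^ (k - 2 * j) * primT n j)

theorem laplacian_potential (k : ℕ) (σ : Fin n → ℂ) :
    ∑ i, pderiv i (pderiv i (potential k σ)) = 0 := by
  have h1 : ∑ i, pderiv i (pderiv i (potential k σ)) = ∑ j ∈ range (k / 2 + 1),
      C ((gegCoeff (n / 2) j (k - 2 * j) : ℂ) * bilin σ σ ^ j) *
        ∑ i, pderiv i (pderiv i (linForm σ ^ (k - 2 * j) * primT n j)) := by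
    simp only [potential, map_sum, pderiv_C_mul]
    rw [sum_comm]
    simp only [mul_sum]
  set h : ℕ → Poly n := fun j =>
    C ((gegCoeff (n / 2) j (k - 2 * j) : ℂ) * bilin σ σ ^ j) *
      (2 * (j : Poly n) *
        (2 * ((k - 2 * j : ℕ) : Poly n) + 2 * (j : Poly n) + (n : Poly n)) *
          linForm σ ^ (k - 2 * j) * primT n (j - 1)) with hh
  set g : ℕ → Poly n := fun j =>
    C ((gegCoeff (n / 2) j (k - 2 * j) : ℂ) * bilin σ σ ^ j) *
      (((k - 2 * j : ℕ) : Poly n) *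
        ((k - 2 * j - 1 : ℕ) : Poly n) *
          C (bilin σ σ) * linForm σ ^ (k - 2 * j - 2) * primT n j) with hg
  have h2 : ∑ i, pderiv i (pderiv i (potential k σ)) =
      ∑ j ∈ range (k / 2 + 1), g j + ∑ j ∈ range (k / 2 + 1), h j := by
    rw [h1, ← sum_add_distrib]
    refine sum_congr rfl fun j _ => ?_
    rw [laplacian_linForm_pow_mul_primT, mul_add]
  -- by the recursion of the Gegenbauer coefficients, the two parts of the Laplacian telescope
  have h3 : ∀ j ∈ range (k / 2), g j = -h (j + 1) := by
    intro j hj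
    rw [mem_range] at hj
    obtain ⟨a, ha⟩ : ∃ a, k = 2 * j + 2 + a := ⟨k - 2 * j - 2, by omega⟩
    have e1 : k - 2 * j = a + 2 := by omega
    have e2 : k - 2 * (j + 1) = a := by omega
    have hc := gegCoeff_succ_left ((n : ℝ) / 2) j a
    have hc' : (gegCoeff (n / 2) (j + 1) a : ℂ) * (2 * (j + 1) * (2 * a + 2 * (j + 1) + n)) =
        -((gegCoeff (n / 2) j (a + 2) : ℂ) * ((a + 2) * (a + 1))) := by
      have := congrArg (fun r : ℝ => (r : ℂ)) hc
      push_cast at this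
      linear_combination this
    have hC := congrArg (C (σ := Fin (n + 1))) hc'
    simp only [hg, hh, e1, e2, Nat.add_sub_cancel, show a + 2 - 1 = a + 1 by omega]
    simp only [map_mul, map_neg, map_add, map_natCast, map_ofNat, map_one, map_pow] at hC ⊢
    push_cast
    linear_combination (C (bilin σ σ) ^ (j + 1) * linForm σ ^ a * primT n j) * hC
  have h4 : g (k / 2) = 0 := by
    have : k - 2 * (k / 2) = 0 ∨ k - 2 * (k / 2) = 1 := by omega
    rcases this with e | e <;> simp [hg, e]
  have h5 : h 0 = 0 := by simp [hh]
  rw [h2, sum_range_succ, sum_range_succ', h4, h5, sum_congr rfl h3, sum_neg_distrib]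
  ring

lemma isHomogeneous_linForm (σ : Fin n → ℂ) : (linForm σ).IsHomogeneous 1 :=
  IsHomogeneous.sum _ _ _ fun _ _ => isHomogeneous_C_mul_X _ _

lemma isHomogeneous_sqForm : (sqForm n).IsHomogeneous 2 :=
  IsHomogeneous.sum _ _ _ fun _ _ => isHomogeneous_X_pow _ _

lemma isHomogeneous_primT (j : ℕ) : (primT n j).IsHomogeneous (2 * j + 1) := by
  induction j with
  | zero => exact isHomogeneous_X _ _
  | succ j ih =>
    refine IsHomogeneous.C_mul (IsHomogeneous.add ?_ ?_) _
    · have hc : (2 * ((j : Poly n) + 1)) = C (2 * ((j : ℂ) + 1)) := by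
        simp only [map_add, map_mul, map_natCast, map_ofNat, map_one]
      rw [hc, mul_assoc]
      refine IsHomogeneous.C_mul ?_ _
      rw [show 2 * (j + 1) + 1 = 2 + (2 * j + 1) by ring]
      exact (isHomogeneous_sqForm.add (isHomogeneous_X_pow _ _)).mul ih
    · rw [show 2 * (j + 1) + 1 = 1 + 2 * (j + 1) by ring]
      exact (isHomogeneous_X _ _).mul (isHomogeneous_sqForm.pow _)

lemma isHomogeneous_potential (k : ℕ) (σ : Fin n → ℂ) :
    (potential k σ).IsHomogeneous (k + 1) := by
  refine IsHomogeneous.sum _ _ _ fun j hj => IsHomogeneous.C_mul ?_ _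
  rw [mem_range] at hj
  have := ((isHomogeneous_linForm σ).pow (k - 2 * j)).mul (isHomogeneous_primT (n := n) j)
  rwa [show 1 * (k - 2 * j) + (2 * j + 1) = k + 1 by omega] at this

lemma linForm_smul (t : ℂ) (σ : Fin n → ℂ) : linForm (t • σ) = C t * linForm σ := by
  simp only [linForm, mul_sum, Pi.smul_apply, smul_eq_mul, C_mul, mul_assoc]

lemma potential_smul (k : ℕ) (t : ℂ) (σ : Fin n → ℂ) :
    potential k (t • σ) = C (t ^ k) * potential k σ := by
  rw [potential, potential, mul_sum]
  refine sum_congr rfl fun j hj => ?_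
  rw [mem_range] at hj
  have : t ^ k = t ^ (k - 2 * j) * (t * t) ^ j := by
    rw [← sq, ← pow_mul, ← pow_add]; congr 1; omega
  rw [this, linForm_smul, bilin_smul_smul, mul_pow, mul_pow]
  simp only [C_mul, C_pow]
  ring

/-- The conjugate gradient of the potential. It is a left complex regular polynomial map of `z` that
extends `C_k(⟨σ, z'⟩, ⟨σ, σ⟩ ⟨z', z'⟩) e_0` from `z₀ = 0`. -/
noncomputable def regPoly (k : ℕ) (σ : Fin n → ℂ) (z : Fin (n + 1) → ℂ) : Fin (n + 1) → ℂ :=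
  conjGrad (potential k σ) z

lemma regPoly_smul_left (k : ℕ) (t : ℂ) (σ : Fin n → ℂ) (z : Fin (n + 1) → ℂ) :
    regPoly k (t • σ) z = t ^ k • regPoly k σ z := by
  funext j
  simp only [regPoly, conjGrad_apply, potential_smul, pderiv_C_mul, map_mul, eval_C,
    Pi.smul_apply, smul_eq_mul]
  ring

lemma exists_isHomogeneous_regPoly (k : ℕ) (σ : Fin n → ℂ) (j : Fin (n + 1)) :
    ∃ p : Poly n, p.IsHomogeneous k ∧
      ∀ z, regPoly k σ z j = eval z p := by
  refine ⟨C (if j = 0 then 1 else -1) * pderiv j (potential k σ),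
    IsHomogeneous.C_mul (isHomogeneous_potential k σ).pderiv _, fun z => ?_⟩
  rw [regPoly, conjGrad_apply]
  by_cases hj : j = 0 <;> simp [hj]

lemma regPoly_smul_right (k : ℕ) (t : ℂ) (σ : Fin n → ℂ) (z : Fin (n + 1) → ℂ) :
    regPoly k σ (t • z) = t ^ k • regPoly k σ z := by
  funext j
  obtain ⟨p, hp, h⟩ := exists_isHomogeneous_regPoly k σ j
  rw [Pi.smul_apply, h, h, eval_smul_of_isHomogeneous hp, smul_eq_mul]

lemma leftComplexRegularOn_regPoly (k : ℕ) (σ : Fin n → ℂ) :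
    LeftComplexRegularOn (regPoly k σ) Set.univ :=
  leftComplexRegularOn_conjGrad (laplacian_potential k σ)

lemma eval_linForm (σ : Fin n → ℂ) (z : Fin (n + 1) → ℂ) :
    eval z (linForm σ) = ∑ i : Fin n, σ i * z i.succ := by
  simp [linForm]

/-- The components of `regPoly` depend holomorphically on both variables. -/
lemma contDiff_regPoly (k : ℕ) :
    ContDiff ℂ 1 (fun q : (Fin n → ℂ) × (Fin (n + 1) → ℂ) => regPoly k q.1 q.2) := by
  have hT : ∀ (p : Poly n),
      ContDiff ℂ 1 (fun q : (Fin n → ℂ) × (Fin (n + 1) → ℂ) => eval q.2 p) :=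
    fun p => (contDiff_eval p).comp contDiff_snd
  have hX : ∀ i : Fin n, ContDiff ℂ 1 (fun q : (Fin n → ℂ) × (Fin (n + 1) → ℂ) => q.1 i) :=
    fun i => (contDiff_apply ℂ ℂ i).comp contDiff_fst
  have hL : ContDiff ℂ 1
      (fun q : (Fin n → ℂ) × (Fin (n + 1) → ℂ) => eval q.2 (linForm q.1)) := by
    simp only [eval_linForm]
    exact ContDiff.sum fun i _ => (hX i).mul ((contDiff_apply ℂ ℂ i.succ).comp contDiff_snd)
  have hB : ContDiff ℂ 1
      (fun q : (Fin n → ℂ) × (Fin (n + 1) → ℂ) => bilin q.1 q.1) :=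
    ContDiff.sum fun i _ => (hX i).mul (hX i)
  rw [contDiff_pi]
  intro j
  simp only [regPoly, conjGrad_apply, potential, map_sum, pderiv_C_mul, eval_C, eval_mul, mul_sum]
  refine ContDiff.sum fun l _ => (hT _).mul ((contDiff_const.mul (hB.pow l)).mul ?_)
  simp only [pderiv_mul, pderiv_pow, eval_add, eval_mul, eval_pow, map_natCast]
  refine ContDiff.add (ContDiff.mul (ContDiff.mul (contDiff_const.mul (hL.pow _)) ?_) (hT _))
    ((hL.pow _).mul (hT _))
  refine Fin.cases ?_ (fun i => ?_) j
  · simp only [pderiv_zero_linForm, map_zero]; exact contDiff_const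
  · simp only [pderiv_succ_linForm, eval_C]; exact hX i

lemma eval_cons_zero_primT (z : Fin n → ℂ) (j : ℕ) : eval (Fin.cons 0 z) (primT n j) = 0 := by
  induction j with
  | zero => simp [primT_zero]
  | succ j ih => simp [primT, ih]

lemma eval_cons_sqForm (z₀ : ℂ) (z : Fin n → ℂ) : eval (Fin.cons z₀ z) (sqForm n) = bilin z z := by
  simp [sqForm, bilin, sq]

/-- On `z₀ = 0` the map `regPoly` is a Gegenbauer polynomial. -/
lemma regPoly_cons_zero (k : ℕ) (σ z : Fin n → ℂ) :
    regPoly k σ (Fin.cons 0 z) =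
      Fin.cons (geg (n / 2) k (bilin σ z) (bilin σ σ * bilin z z)) 0 := by
  have hl : eval (Fin.cons 0 z : Fin (n + 1) → ℂ) (linForm σ) = bilin σ z := by
    simp [eval_linForm, bilin]
  funext j
  refine Fin.cases ?_ (fun i => ?_) j
  · simp only [regPoly, conjGrad, Fin.cons_zero, potential, map_sum, pderiv_mul,
      pderiv_pow, pderiv_zero_linForm, pderiv_zero_primT, map_mul, map_add, map_pow,
      eval_cons_sqForm, eval_cons_zero_primT, eval_C, hl, geg, map_zero]
    refine sum_congr rfl fun j _ => ?_
    rw [mul_pow]; ring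
  · simp only [regPoly, conjGrad, Fin.cons_succ, potential, map_sum, pderiv_mul,
      pderiv_succ_primT, map_mul, map_add, eval_cons_zero_primT, Pi.zero_apply]
    simp

/-- The integral representation of `primT` at real points. -/
lemma eval_primT_toC (x : Fin (n + 1) → ℝ) (j : ℕ) :
    eval (toC x) (primT n j) = ((∫ v in (0 : ℝ)..1,
      x 0 * (∑ i : Fin n, x i.succ ^ 2 + (1 - v ^ 2) * x 0 ^ 2) ^ j : ℝ) : ℂ) := by
  set c := ∑ i : Fin n, x i.succ ^ 2 with hc
  have hsq : eval (toC x) (sqForm n) = (c : ℂ) := by simp [sqForm, toC, hc]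
  induction j with
  | zero => simp [primT_zero, toC]
  | succ j ih =>
    have h := congrArg (eval (toC x)) (primT_succ (n := n) j)
    have h3 : (2 * (j : ℂ) + 3) ≠ 0 := by exact_mod_cast (2 * j + 2).succ_ne_zero
    simp only [map_mul, map_add, map_natCast, map_ofNat, map_one, map_pow, eval_X, hsq, ih] at h
    apply mul_left_cancel₀ h3
    rw [h]
    have hx0 : toC x 0 = (x 0 : ℂ) := rfl
    rw [hx0]
    -- integrate the derivative of `v (c + (1 - v²) x₀²)^(j+1)` over `[0, 1]`
    have hd : ∀ v ∈ Set.uIcc (0 : ℝ) 1, HasDerivAt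
        (fun v : ℝ => x 0 * (v * (c + (1 - v ^ 2) * x 0 ^ 2) ^ (j + 1)))
        ((2 * j + 3) * (x 0 * (c + (1 - v ^ 2) * x 0 ^ 2) ^ (j + 1)) -
          2 * (j + 1) * (c + x 0 ^ 2) * (x 0 * (c + (1 - v ^ 2) * x 0 ^ 2) ^ j)) v := by
      intro v _
      have h1 : HasDerivAt (fun v : ℝ => c + (1 - v ^ 2) * x 0 ^ 2) (-(2 * v) * x 0 ^ 2) v := by
        have := (((hasDerivAt_pow 2 v).const_sub 1).mul_const (x 0 ^ 2)).const_add c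
        simpa using this
      have h2 := ((hasDerivAt_id v).mul (h1.pow (j + 1))).const_mul (x 0)
      refine h2.congr_deriv ?_
      simp only [Nat.add_sub_cancel, id, Pi.pow_apply]
      push_cast
      ring
    have hI := intervalIntegral.integral_eq_sub_of_hasDerivAt hd
      (Continuous.intervalIntegrable (by fun_prop) _ _)
    rw [intervalIntegral.integral_sub (Continuous.intervalIntegrable (by fun_prop) _ _)
      (Continuous.intervalIntegrable (by fun_prop) _ _),
      intervalIntegral.integral_const_mul (2 * (j : ℝ) + 3),
      intervalIntegral.integral_const_mul (2 * ((j : ℝ) + 1) * (c + x 0 ^ 2))] at hI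
    have hI' := congrArg (fun r : ℝ => (r : ℂ)) hI
    simp only [one_pow, sub_self, zero_mul, add_zero, one_mul] at hI'
    push_cast at hI'
    linear_combination -hI'

/-- On the real unit sphere the potential is bounded by the value of the Gegenbauer polynomial
at `1`. -/
lemma norm_eval_potential_le (hn : 1 ≤ n) (k : ℕ) {ω : Fin n → ℝ} (hω : ω ∈ unitSphere n)
    {x : Fin (n + 1) → ℝ} (hx : x ∈ unitSphere (n + 1)) :
    ‖eval (toC x) (potential k (toC ω))‖ ≤ negBinom n k := by
  have hx' : x 0 ^ 2 + ∑ i : Fin n, x i.succ ^ 2 = 1 := by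
    rw [← Fin.sum_univ_succ fun i => x i ^ 2]; exact hx
  have hω' : ∑ i, ω i ^ 2 = 1 := hω
  set c := ∑ i : Fin n, x i.succ ^ 2 with hc
  set p := ∑ i : Fin n, ω i * x i.succ with hp
  have hpc : p ^ 2 ≤ c := by
    have := sum_mul_sq_le_sq_mul_sq univ ω fun i => x i.succ
    rwa [hω', one_mul] at this
  have hl : eval (toC x) (linForm (toC ω)) = (p : ℂ) := by
    simp [eval_linForm, toC, hp]
  set g : ℝ → ℝ := fun v => ∑ j ∈ range (k / 2 + 1), gegCoeff (n / 2) j (k - 2 * j) *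
    p ^ (k - 2 * j) * (x 0 * (c + (1 - v ^ 2) * x 0 ^ 2) ^ j) with hg
  have hV : eval (toC x) (potential k (toC ω)) = ((∫ v in (0 : ℝ)..1, g v : ℝ) : ℂ) := by
    rw [hg, intervalIntegral.integral_finsetSum
      (fun j _ => Continuous.intervalIntegrable (by fun_prop) _ _)]
    simp only [intervalIntegral.integral_const_mul, potential, map_sum, map_mul, eval_C,
      bilin_toC_self hω, one_pow, mul_one, map_pow, hl, eval_primT_toC]
    push_cast
    exact sum_congr rfl fun j _ => by ring
  rw [hV, Complex.norm_real]
  have hb : ∀ v ∈ Set.uIoc (0 : ℝ) 1, ‖g v‖ ≤ negBinom n k := by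
    intro v hv
    rw [Set.uIoc_of_le zero_le_one] at hv
    have hv2 : v ^ 2 ≤ 1 := pow_le_one₀ hv.1.le hv.2
    have e : ((g v : ℝ) : ℂ) = x 0 * geg (n / 2) k p ((c + (1 - v ^ 2) * x 0 ^ 2 : ℝ) : ℂ) := by
      simp only [hg, geg, mul_sum]
      push_cast
      exact sum_congr rfl fun j _ => by ring
    have hx0 : |x 0| ≤ 1 := by
      rw [← sq_le_one_iff_abs_le_one]
      have : 0 ≤ c := sum_nonneg fun _ _ => sq_nonneg _
      linarith
    have hgeg := norm_geg_le (x := (n : ℝ) / 2) (by positivity) k (p := p)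
      (c := c + (1 - v ^ 2) * x 0 ^ 2) (by nlinarith [sq_nonneg (x 0)])
      (by nlinarith [sq_nonneg (x 0), sq_nonneg v])
    rw [show 2 * ((n : ℝ) / 2) = n by ring] at hgeg
    rw [← Complex.norm_real, e, norm_mul, Complex.norm_real, Real.norm_eq_abs]
    calc _ ≤ 1 * negBinom n k := by gcongr
      _ = _ := one_mul _
  have := intervalIntegral.norm_integral_le_of_norm_le_const hb
  simpa using this

end Potential

end LieBallCR

namespace LieBallCR

open Metric Filter Topology

/-! ### Uniqueness of regular extensions -/

section Uniqueness

variable {n : ℕ} {g : (Fin (n + 1) → ℂ) → (Fin (n + 1) → ℂ)}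

lemma cons_add_smul_single_succ (a t : ℂ) (w : Fin n → ℂ) (i : Fin n) :
    (Fin.cons a w : Fin (n + 1) → ℂ) + t • (Pi.single i.succ 1 : Fin (n + 1) → ℂ) =
      (Fin.cons a (w + t • (Pi.single i 1 : Fin n → ℂ)) : Fin (n + 1) → ℂ) := by
  funext j
  refine Fin.cases ?_ (fun l => ?_) j
  · simp [Fin.succ_ne_zero]
  · by_cases h : l = i
    · subst h; simp
    · simp [h]

lemma cons_zero_add_smul_single_zero (a t : ℂ) (w : Fin n → ℂ) :
    (Fin.cons 0 w : Fin (n + 1) → ℂ) + t • Pi.single 0 a = Fin.cons (t * a) w := by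
  funext j
  refine Fin.cases ?_ (fun l => ?_) j
  · simp
  · simp [Fin.succ_ne_zero]

lemma cons_mem_ball {a : ℂ} {w : Fin n → ℂ} {R : ℝ} (ha : ‖a‖ < R) (hw : ∀ i, ‖w i‖ < R) :
    (Fin.cons a w : Fin (n + 1) → ℂ) ∈ ball 0 R := by
  rw [mem_ball_zero_iff, pi_norm_lt_iff ((norm_nonneg _).trans_lt ha)]
  exact fun j => Fin.cases ha hw j

/-- For a regular map the derivative in `z₀` is controlled by the other partial derivatives. -/
lemma norm_fderiv_single_zero_le {z : Fin (n + 1) → ℂ} (hd : dirac g z = 0) {B : ℝ} (hB0 : 0 ≤ B)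
    (hB : ∀ i : Fin n, ‖fderiv ℂ g z (Pi.single i.succ 1)‖ ≤ B) :
    ‖fderiv ℂ g z (Pi.single 0 1)‖ ≤ n * B := by
  obtain ⟨h0, h1⟩ := eq_of_sum_smul_cliffE_mul_eq_zero hd
  refine (pi_norm_le_iff_of_nonneg (by positivity)).2 fun j => ?_
  refine Fin.cases ?_ (fun i => ?_) j
  · rw [h0]
    refine (norm_sum_le _ _).trans ?_
    calc _ ≤ ∑ _i : Fin n, B :=
          Finset.sum_le_sum fun i _ => (norm_le_pi_norm _ i.succ).trans (hB i)
      _ = n * B := by simp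
  · rw [h1, norm_neg]
    have hn : (1 : ℝ) ≤ n := by exact_mod_cast Fin.pos i
    calc _ ≤ B := (norm_le_pi_norm _ 0).trans (hB i)
      _ ≤ n * B := le_mul_of_one_le_left hB0 hn

/-- The Cauchy–Kovalevskaya majorant: each integration in `z₀` gains a factor `‖z₀‖ / N` and costs
a Cauchy estimate on discs of radius `ε` in the other variables. -/
lemma norm_le_of_regular_of_vanishing {R M : ℝ} (hg : DifferentiableOn ℂ g (ball 0 R))
    (hd : ∀ z ∈ ball 0 R, dirac g z = 0) (hM : ∀ z ∈ ball 0 R, ‖g z‖ ≤ M)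
    (h0 : ∀ w : Fin n → ℂ, (∀ i, ‖w i‖ < R) → g (Fin.cons 0 w) = 0) {ε : ℝ} (hε : 0 < ε) (N : ℕ) :
    ∀ (a : ℂ) (w : Fin n → ℂ), ‖a‖ < R → (∀ i, ‖w i‖ + N * ε < R) →
      ‖g (Fin.cons a w)‖ ≤ M * (n / ε) ^ N * ‖a‖ ^ N / N.factorial := by
  induction N with
  | zero =>
    intro a w ha hw
    simpa using hM _ (cons_mem_ball ha fun i => by simpa using hw i)
  | succ N ih =>
    intro a w ha hw
    have hR : 0 < R := (norm_nonneg a).trans_lt ha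
    have hM0 : 0 ≤ M := (norm_nonneg _).trans (hM 0 (mem_ball_self hR))
    have hw1 : ∀ i, ‖w i‖ + ε < R := fun i => by
      have := hw i; push_cast at this; nlinarith [mul_nonneg N.cast_nonneg hε.le]
    have hw0 : ∀ i, ‖w i‖ < R := fun i => by linarith [hw1 i]
    have hpart : ∀ (b : ℂ), ‖b‖ < R → ∀ i : Fin n,
        ‖fderiv ℂ g (Fin.cons b w) (Pi.single i.succ 1)‖ ≤
          M * (n / ε) ^ N * ‖b‖ ^ N / N.factorial / ε := by
      intro b hb i
      have hmem : ∀ t : ℂ, ‖t‖ ≤ ε → ∀ j, ‖(w + t • (Pi.single i 1 : Fin n → ℂ)) j‖ ≤ ‖w j‖ + ε := by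
        intro t ht j
        refine (norm_add_le _ _).trans ?_
        gcongr
        by_cases h : j = i
        · subst h; simpa using ht
        · simpa [h] using hε.le
      have hgd := (hg.differentiableAt (isOpen_ball.mem_nhds (cons_mem_ball hb hw0)))
      have hline : HasDerivAt
          (fun t : ℂ => g ((Fin.cons b w : Fin (n + 1) → ℂ) + t • Pi.single i.succ 1))
          (fderiv ℂ g (Fin.cons b w) (Pi.single i.succ 1)) 0 :=
        hgd.hasFDerivAt.hasLineDerivAt (Pi.single i.succ (1 : ℂ))
      rw [← hline.deriv]
      refine Complex.norm_deriv_le_of_forall_mem_sphere_norm_le hε ?_ ?_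
      · refine DifferentiableOn.diffContOnCl ?_
        rw [closure_ball _ hε.ne']
        refine hg.comp (by fun_prop) fun t ht => ?_
        rw [cons_add_smul_single_succ]
        rw [mem_closedBall_zero_iff] at ht
        exact cons_mem_ball hb fun j => (hmem t ht j).trans_lt (hw1 j)
      · intro t ht
        rw [mem_sphere_zero_iff_norm] at ht
        rw [cons_add_smul_single_succ]
        refine ih b _ hb fun j => ?_
        have h1 := hmem t ht.le j
        have h2 := hw j
        push_cast at h2
        linarith
    have hz : ∀ s ∈ Set.Icc (0 : ℝ) 1, ‖(s : ℂ) * a‖ < R := fun s hs => by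
      rw [norm_mul, Complex.norm_real, Real.norm_of_nonneg hs.1]
      exact (mul_le_of_le_one_left (norm_nonneg a) hs.2).trans_lt ha
    have hderiv : ∀ s ∈ Set.Icc (0 : ℝ) 1, HasDerivAt
        (fun s : ℝ => g (Fin.cons ((s : ℂ) * a) w))
        (a • fderiv ℂ g (Fin.cons ((s : ℂ) * a) w) (Pi.single 0 1)) s := by
      intro s hs
      have hgd := (hg.differentiableAt (isOpen_ball.mem_nhds (cons_mem_ball (hz s hs) hw0)))
      have hcurve : HasDerivAt (fun s : ℝ => (Fin.cons ((s : ℂ) * a) w : Fin (n + 1) → ℂ))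
          (Pi.single 0 a) s := by
        simp only [← cons_zero_add_smul_single_zero]
        have := (Complex.ofRealCLM.hasDerivAt (x := s)).smul_const (Pi.single 0 a : Fin (n + 1) → ℂ)
        simpa using this.const_add (Fin.cons 0 w : Fin (n + 1) → ℂ)
      have := (hgd.hasFDerivAt.restrictScalars ℝ).comp_hasDerivAt s hcurve
      refine this.congr_deriv ?_
      have e : (Pi.single 0 a : Fin (n + 1) → ℂ) = a • Pi.single 0 1 := by
        rw [← Pi.single_smul, smul_eq_mul, mul_one]
      rw [ContinuousLinearMap.coe_restrictScalars', e, map_smul]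
    -- integrate over `s ↦ (s a, w)`, starting from `s = 0`, where `g` vanishes
    set K : ℝ := M * (n / ε) ^ (N + 1) * ‖a‖ ^ (N + 1) / (N + 1).factorial with hK
    have hB : ∀ s : ℝ, HasDerivAt (fun s : ℝ => K * s ^ (N + 1)) (K * ((N + 1 : ℕ) * s ^ N)) s :=
      fun s => by simpa using (hasDerivAt_pow (N + 1) s).const_mul K
    have hfin := image_norm_le_of_norm_deriv_right_le_deriv_boundary
      (f := fun s : ℝ => g (Fin.cons ((s : ℂ) * a) w)) (a := 0) (b := 1)
      (fun s hs => (hderiv s hs).continuousAt.continuousWithinAt)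
      (fun s hs => (hderiv s ⟨hs.1, hs.2.le⟩).hasDerivWithinAt) (B := fun s => K * s ^ (N + 1))
      (by simp [h0 w hw0]) hB
      (fun s hs => by
        have hs' : s ∈ Set.Icc (0 : ℝ) 1 := ⟨hs.1, hs.2.le⟩
        rw [norm_smul]
        have h1 := norm_fderiv_single_zero_le (hd _ (cons_mem_ball (hz s hs') hw0))
          (by positivity) (hpart _ (hz s hs'))
        refine (mul_le_mul_of_nonneg_left h1 (norm_nonneg a)).trans (le_of_eq ?_)
        rw [norm_mul, Complex.norm_real, Real.norm_of_nonneg hs.1, hK, Nat.factorial_succ]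
        have : (N.factorial : ℝ) ≠ 0 := by positivity
        push_cast
        rw [pow_succ (n / ε : ℝ), mul_pow, pow_succ ‖a‖]
        field_simp)
      (Set.right_mem_Icc.2 zero_le_one)
    simpa using hfin

/-- A regular map that vanishes for `z₀ = 0` vanishes near the origin. -/
lemma eventually_eq_zero_of_regular {U : Set (Fin (n + 1) → ℂ)} (hU : U ∈ 𝓝 0)
    (hg : DifferentiableOn ℂ g U) (hd : ∀ z ∈ U, dirac g z = 0)
    (h0 : ∀ w : Fin n → ℂ, Fin.cons 0 w ∈ U → g (Fin.cons 0 w) = 0) :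
    ∀ᶠ z in 𝓝 0, g z = 0 := by
  have hc : ContinuousAt g 0 := (hg.differentiableAt hU).continuousAt
  obtain ⟨R, hR, hRU⟩ := Metric.mem_nhds_iff.1
    (inter_mem hU (hc.norm.eventually_lt continuousAt_const (lt_add_one ‖g 0‖)))
  set M := ‖g 0‖ + 1
  have key := fun ε hε N => norm_le_of_regular_of_vanishing (g := g) (R := R) (M := M)
    (hg.mono fun z hz => (hRU hz).1) (fun z hz => hd z (hRU hz).1) (fun z hz => (hRU hz).2.le)
    (fun w hw => h0 w (hRU (cons_mem_ball (by simpa using hR) hw)).1) (ε := ε) hε N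
  have hsmall : ∀ᶠ z : Fin (n + 1) → ℂ in 𝓝 0, ‖z‖ < R / 2 ∧
      2 * n * Real.exp 1 / R * ‖z 0‖ < 1 := by
    refine (ContinuousAt.eventually_lt (by fun_prop) continuousAt_const (by simpa using hR)).and
      (ContinuousAt.eventually_lt
        (continuous_const.mul (continuous_apply (0 : Fin (n + 1))).norm).continuousAt
        continuousAt_const (by simp))
  filter_upwards [hsmall] with z ⟨hz1, hz2⟩
  rw [← norm_le_zero_iff]
  set q := 2 * n * Real.exp 1 / R * ‖z 0‖ with hq
  have hq0 : 0 ≤ q := by positivity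
  have hlim : Tendsto (fun N : ℕ => M * q ^ N) atTop (𝓝 (M * 0)) :=
    (tendsto_pow_atTop_nhds_zero_of_lt_one hq0 hz2).const_mul M
  rw [mul_zero] at hlim
  refine ge_of_tendsto hlim (eventually_atTop.2 ⟨1, fun N hN => ?_⟩)
  have hN0 : (0 : ℝ) < N := by exact_mod_cast hN
  have hcons : z = Fin.cons (z 0) fun i => z i.succ := (Fin.cons_self_tail z).symm
  -- with `ε = R / (2 N)` the factor `N^N / N!` from the majorant is at most `e^N`
  have h1 := key (R / (2 * N)) (by positivity) N (z 0) (fun i => z i.succ)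
    ((norm_le_pi_norm z 0).trans_lt (by linarith)) fun i => by
      have := (norm_le_pi_norm z i.succ).trans_lt hz1
      have e : N * (R / (2 * N)) = R / 2 := by field_simp
      rw [e]; linarith
  rw [← hcons] at h1
  refine h1.trans ?_
  have hM0 : 0 ≤ M := by positivity
  have hfac : (N : ℝ) ^ N / N.factorial ≤ Real.exp 1 ^ N := by
    rw [← Real.exp_nat_mul, mul_one]
    exact Real.pow_div_factorial_le_exp _ hN0.le N
  calc M * (n / (R / (2 * N))) ^ N * ‖z 0‖ ^ N / N.factorial
      = M * (2 * n / R * ‖z 0‖) ^ N * ((N : ℝ) ^ N / N.factorial) := by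
        rw [show (n : ℝ) / (R / (2 * N)) = 2 * n / R * N by field_simp, mul_pow, mul_pow]; ring
    _ ≤ M * (2 * n / R * ‖z 0‖) ^ N * Real.exp 1 ^ N := by gcongr
    _ = M * q ^ N := by rw [mul_assoc, ← mul_pow, hq]; ring

/-- Regular maps on a domain whose intersections with the complex lines through the origin are
connected are determined by their values for `z₀ = 0`. -/
theorem eqOn_of_regular {f : (Fin (n + 1) → ℂ) → (Fin (n + 1) → ℂ)} {U : Set (Fin (n + 1) → ℂ)}
    (hU : IsOpen U) (h0 : 0 ∈ U) (hconn : ∀ z ∈ U, IsPreconnected {t : ℂ | t • z ∈ U})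
    (hf : LeftComplexRegularOn f U) (hg : LeftComplexRegularOn g U)
    (h : ∀ w : Fin n → ℂ, Fin.cons 0 w ∈ U → f (Fin.cons 0 w) = g (Fin.cons 0 w)) :
    Set.EqOn f g U := by
  have hfd := hf.1.differentiableOn one_ne_zero
  have hgd := hg.1.differentiableOn one_ne_zero
  have hd : ∀ z ∈ U, dirac (f - g) z = 0 := by
    intro z hz
    have e : fderiv ℂ (f - g) z = fderiv ℂ f z - fderiv ℂ g z :=
      fderiv_sub (hfd.differentiableAt (hU.mem_nhds hz)) (hgd.differentiableAt (hU.mem_nhds hz))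
    have e1 := hf.2 z hz
    have e2 := hg.2 z hz
    unfold dirac at e1 e2 ⊢
    rw [← sub_eq_zero.2 (e1.trans e2.symm)]
    simp only [e, ← Finset.sum_sub_distrib, ← sub_smul]
    rfl
  have hev := eventually_eq_zero_of_regular (hU.mem_nhds h0) (hfd.sub hgd) hd
    fun w hw => sub_eq_zero.2 (h w hw)
  intro z hz
  have hDo : IsOpen {t : ℂ | t • z ∈ U} := hU.preimage (by fun_prop)
  have han : AnalyticOnNhd ℂ (fun t : ℂ => (f - g) (t • z)) {t : ℂ | t • z ∈ U} :=
    DifferentiableOn.analyticOnNhd ((hfd.sub hgd).comp (by fun_prop) fun t ht => ht) hDo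
  have hev' : (fun t : ℂ => (f - g) (t • z)) =ᶠ[𝓝 0] 0 := by
    have ht : Tendsto (fun t : ℂ => t • z) (𝓝 0) (𝓝 0) := by
      have : ContinuousAt (fun t : ℂ => t • z) 0 := by fun_prop
      simpa [ContinuousAt] using this
    exact ht.eventually hev
  have := han.eqOn_zero_of_preconnected_of_eventuallyEq_zero (hconn z hz) (by simpa using h0) hev'
    (show (1 : ℂ) ∈ {t : ℂ | t • z ∈ U} by simpa using hz)
  simpa [sub_eq_zero] using this

end Uniqueness

/-! ### Locally normally convergent series of holomorphic maps -/

section Series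

variable {E F : Type*} [NormedAddCommGroup E] [NormedSpace ℂ E] [NormedAddCommGroup F]
  [NormedSpace ℂ F]

/-- Cauchy's estimate for the Fréchet derivative. -/
lemma norm_fderiv_le_of_ball {f : E → F} {x y : E} {r B : ℝ} (hr : 0 < r)
    (hf : DifferentiableOn ℂ f (ball x (2 * r))) (hB : ∀ y ∈ ball x (2 * r), ‖f y‖ ≤ B)
    (hy : y ∈ ball x r) : ‖fderiv ℂ f y‖ ≤ B / r := by
  have hsub : ∀ v : E, ‖v‖ ≤ r → y + v ∈ ball x (2 * r) := fun v hv => by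
    rw [mem_ball, dist_eq_norm] at *
    calc ‖y + v - x‖ = ‖(y - x) + v‖ := by rw [add_sub_right_comm]
      _ ≤ ‖y - x‖ + ‖v‖ := norm_add_le _ _
      _ < 2 * r := by linarith
  have hyU : y ∈ ball x (2 * r) := by simpa using hsub 0 (by simpa using hr.le)
  have hB0 : 0 ≤ B := (norm_nonneg _).trans (hB y hyU)
  refine ContinuousLinearMap.opNorm_le_bound _ (by positivity) fun v => ?_
  rcases eq_or_ne v 0 with rfl | hv
  · simp
  have hv0 : 0 < ‖v‖ := norm_pos_iff.2 hv
  have hline : HasDerivAt (fun t : ℂ => f (y + t • v)) (fderiv ℂ f y v) 0 :=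
    (hf.differentiableAt (isOpen_ball.mem_nhds hyU)).hasFDerivAt.hasLineDerivAt v
  have hmem : ∀ t : ℂ, ‖t‖ ≤ r / ‖v‖ → y + t • v ∈ ball x (2 * r) := fun t ht =>
    hsub _ (by rw [norm_smul]; exact (le_div_iff₀ hv0).1 ht)
  have h := Complex.norm_deriv_le_of_forall_mem_sphere_norm_le (c := 0) (R := r / ‖v‖) (C := B)
    (f := fun t : ℂ => f (y + t • v)) (by positivity)
    (DifferentiableOn.diffContOnCl (by
      rw [closure_ball _ (by positivity)]
      exact hf.comp (by fun_prop) fun t ht => hmem t (by simpa using ht)))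
    (fun t ht => hB _ (hmem t (by simpa using (mem_sphere_zero_iff_norm.1 ht).le)))
  rw [hline.deriv] at h
  calc _ ≤ B / (r / ‖v‖) := h
    _ = B / r * ‖v‖ := by field_simp

/-- A series of holomorphic maps that is locally dominated by a convergent series of constants is
holomorphic and can be differentiated term by term. -/
theorem contDiffOn_tsum_of_locally_bounded [CompleteSpace F] {f : ℕ → E → F} {U : Set E}
    (hU : IsOpen U) (hf : ∀ k, ContDiffOn ℂ 1 (f k) U)
    (hb : ∀ x ∈ U, ∃ t ∈ 𝓝 x, ∃ u : ℕ → ℝ, Summable u ∧ ∀ k, ∀ y ∈ t, ‖f k y‖ ≤ u k) :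
    ContDiffOn ℂ 1 (fun y => ∑' k, f k y) U ∧
      ∀ x ∈ U, HasSum (fun k => fderiv ℂ (f k) x) (fderiv ℂ (fun y => ∑' k, f k y) x) := by
  have hfd : ∀ k, DifferentiableOn ℂ (f k) U := fun k => (hf k).differentiableOn one_ne_zero
  have key : ∀ x ∈ U, ∃ r > 0, ∃ u : ℕ → ℝ, Summable u ∧ ball x r ⊆ U ∧
      (∀ k, ∀ y ∈ ball x r, ‖fderiv ℂ (f k) y‖ ≤ u k) ∧
      ∀ y ∈ ball x r, HasFDerivAt (fun y => ∑' k, f k y) (∑' k, fderiv ℂ (f k) y) y := by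
    intro x hx
    obtain ⟨t, ht, u, hu, hbd⟩ := hb x hx
    obtain ⟨R, hR, hRU⟩ := Metric.mem_nhds_iff.1 (inter_mem (hU.mem_nhds hx) ht)
    have hr : 0 < R / 2 := by linarith
    have e : 2 * (R / 2) = R := by ring
    have hsub : ball x (R / 2) ⊆ U := fun y hy =>
      (hRU (ball_subset_ball (by linarith) hy)).1
    have hder : ∀ k, ∀ y ∈ ball x (R / 2), ‖fderiv ℂ (f k) y‖ ≤ u k / (R / 2) := fun k y hy =>
      norm_fderiv_le_of_ball hr ((hfd k).mono (by rw [e]; exact fun y hy => (hRU hy).1))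
        (by rw [e]; exact fun y hy => hbd k y (hRU hy).2) hy
    refine ⟨R / 2, hr, fun k => u k / (R / 2), hu.div_const _, hsub, hder, fun y hy => ?_⟩
    refine hasFDerivAt_tsum_of_isPreconnected (hu.div_const (R / 2)) isOpen_ball
      (convex_ball x (R / 2)).isPreconnected
      (fun k y hy => ((hfd k).differentiableAt (hU.mem_nhds (hsub hy))).hasFDerivAt) hder
      (mem_ball_self hr) ?_ hy
    exact Summable.of_norm_bounded hu fun k => hbd k x (hRU (mem_ball_self hR)).2
  have hsum : ∀ x ∈ U, HasSum (fun k => fderiv ℂ (f k) x) (fderiv ℂ (fun y => ∑' k, f k y) x) := by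
    intro x hx
    obtain ⟨r, hr, u, hu, -, hder, hF⟩ := key x hx
    rw [(hF x (mem_ball_self hr)).fderiv]
    exact (Summable.of_norm_bounded hu fun k => hder k x (mem_ball_self hr)).hasSum
  refine ⟨?_, hsum⟩
  rw [← zero_add (1 : WithTop ℕ∞), contDiffOn_succ_iff_fderiv_of_isOpen hU]
  refine ⟨fun x hx => ?_, fun h => by simp at h, ?_⟩
  · obtain ⟨r, hr, u, hu, -, hder, hF⟩ := key x hx
    exact (hF x (mem_ball_self hr)).differentiableAt.differentiableWithinAt
  · rw [contDiffOn_zero]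
    intro x hx
    obtain ⟨r, hr, u, hu, hsub, hder, hF⟩ := key x hx
    have hcont : ContinuousOn (fun y => ∑' k, fderiv ℂ (f k) y) (ball x r) :=
      continuousOn_tsum
        (fun k => ((hf k).continuousOn_fderiv_of_isOpen hU le_rfl).mono hsub) hu hder
    have hcont' : ContinuousOn (fderiv ℂ fun y => ∑' k, f k y) (ball x r) :=
      hcont.congr fun y hy => (hF y hy).fderiv
    exact (hcont'.continuousAt (ball_mem_nhds x hr)).continuousWithinAt

/-- Termwise differentiation preserves regularity. -/
theorem leftComplexRegularOn_tsum {n : ℕ} {f : ℕ → (Fin (n + 1) → ℂ) → (Fin (n + 1) → ℂ)}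
    {U : Set (Fin (n + 1) → ℂ)} (hU : IsOpen U) (hf : ∀ k, LeftComplexRegularOn (f k) U)
    (hb : ∀ x ∈ U, ∃ t ∈ 𝓝 x, ∃ u : ℕ → ℝ, Summable u ∧ ∀ k, ∀ y ∈ t, ‖f k y‖ ≤ u k) :
    LeftComplexRegularOn (fun y => ∑' k, f k y) U := by
  obtain ⟨h1, h2⟩ := contDiffOn_tsum_of_locally_bounded hU (fun k => (hf k).1) hb
  refine ⟨h1, fun x hx => ?_⟩
  -- the Clifford algebra carries no topology, so the equation is tested on linear functionals
  rw [← Module.forall_dual_apply_eq_zero_iff ℂ]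
  intro φ
  have hs : HasSum (fun k => φ (dirac (f k) x)) (φ (dirac (fun y => ∑' k, f k y) x)) := by
    simp only [dirac, map_sum, map_smul, smul_eq_mul]
    refine hasSum_sum fun i _ => hasSum_sum fun j _ => HasSum.mul_right _ ?_
    have e := (h2 x hx).mapL (ContinuousLinearMap.apply ℂ (Fin (n + 1) → ℂ)
      (Pi.single i 1 : Fin (n + 1) → ℂ))
    exact Pi.hasSum.1 e j
  simp only [fun k => (hf k).2 x hx, map_zero] at hs
  exact hs.unique hasSum_zero

end Series

end LieBallCR

namespace LieBallCR

open Filter Topology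

/-! ### Dimensions of spaces of spherical harmonics -/

section Dimension

lemma poch_mul_factorial (m k : ℕ) :
    poch ((m + 1 : ℕ) : ℝ) k * m.factorial = (k + m).factorial := by
  induction k with
  | zero => simp [poch_zero]
  | succ k ih =>
    rw [poch_succ, show k + 1 + m = (k + m) + 1 by ring, Nat.factorial_succ, Nat.cast_mul, ← ih]
    push_cast
    ring

/-- The coefficients `n / (2k + n) N(k, n + 2)` of the expansion are those of `(1 - r)^{-n}`. -/
lemma dimHarm_add_two {n : ℕ} (hn : 1 ≤ n) (k : ℕ) :
    dimHarm k (n + 2) = (2 * k + n) / n * negBinom n k := by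
  obtain ⟨m, rfl⟩ := Nat.exists_eq_add_of_le' hn
  rw [dimHarm, negBinom, show 2 * k + (m + 1 + 2) - 2 = 2 * k + (m + 1) by omega,
    show k + (m + 1 + 2) - 3 = k + m by omega, show m + 1 + 2 - 2 = m + 1 by omega,
    ← poch_mul_factorial, Nat.factorial_succ]
  have : (m.factorial : ℝ) ≠ 0 := by positivity
  have : (k.factorial : ℝ) ≠ 0 := by positivity
  push_cast
  field_simp

lemma negBinom_natCast_le {n : ℕ} (hn : 1 ≤ n) (k : ℕ) :
    negBinom n k ≤ (n * (k + 1)) ^ (n - 1) := by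
  obtain ⟨m, rfl⟩ := Nat.exists_eq_add_of_le' hn
  have h1 : (k + m).factorial ≤ k.factorial * ((m + 1) * (k + 1)) ^ m := by
    rw [← Nat.factorial_mul_ascFactorial]
    refine Nat.mul_le_mul_left _ ((Nat.ascFactorial_le_pow_add _ _).trans ?_)
    exact Nat.pow_le_pow_left (by nlinarith) _
  have h2 : (1 : ℝ) ≤ m.factorial := by exact_mod_cast m.factorial_pos
  have h3 : 0 ≤ poch ((m + 1 : ℕ) : ℝ) k := (poch_pos (by positivity) k).le
  rw [negBinom, div_le_iff₀ (by positivity)]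
  calc poch ((m + 1 : ℕ) : ℝ) k ≤ poch ((m + 1 : ℕ) : ℝ) k * m.factorial :=
        le_mul_of_one_le_right h3 h2
    _ = (k + m).factorial := poch_mul_factorial m k
    _ ≤ ((k.factorial * ((m + 1) * (k + 1)) ^ m : ℕ) : ℝ) := by exact_mod_cast h1
    _ = _ := by rw [Nat.add_sub_cancel]; push_cast; ring

lemma dimHarm_le {n : ℕ} (hn : 1 ≤ n) {k : ℕ} (hk : 1 ≤ k) :
    dimHarm k (n + 2) ≤ 3 * (2 * n) ^ (n - 1) * (k : ℝ) ^ n := by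
  have hn' : (1 : ℝ) ≤ n := by exact_mod_cast hn
  have hk' : (1 : ℝ) ≤ k := by exact_mod_cast hk
  rw [dimHarm_add_two hn]
  calc (2 * k + n) / n * negBinom n k ≤ (3 * k) * (n * (2 * k)) ^ (n - 1) := by
        refine mul_le_mul ?_ ((negBinom_natCast_le hn k).trans ?_)
          (negBinom_pos (by linarith) k).le (by positivity)
        · rw [div_le_iff₀ (by linarith)]; nlinarith
        · gcongr; linarith
    _ = 3 * (2 * n) ^ (n - 1) * (k ^ (n - 1) * k) := by rw [mul_pow, mul_pow, mul_pow]; ring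
    _ = _ := by rw [← pow_succ, Nat.sub_add_cancel hn]

end Dimension

/-! ### Growth of the regular polynomials -/

section Growth

variable {n : ℕ}

/-- A bound for `regPoly k` on the product of the real unit spheres. The factor `e² (k + 1)` is the
loss of the Bernstein inequality for the potential, the factor `√(n + 1)` that of passing from the
components to the Hermitian norm. -/
noncomputable def sphereBound (n k : ℕ) : ℝ :=
  Real.sqrt (n + 1) * (Real.exp 2 * (k + 1) * negBinom n k)

lemma hnorm_regPoly_toC_le (hn : 1 ≤ n) (k : ℕ) {ω : Fin n → ℝ} (hω : ω ∈ unitSphere n)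
    {x : Fin (n + 1) → ℝ} (hx : x ∈ unitSphere (n + 1)) :
    hnorm (regPoly k (toC ω) (toC x)) ≤ sphereBound n k := by
  have hb : 0 ≤ Real.exp 2 * (k + 1) * negBinom n k := by
    have := negBinom_pos (show (0 : ℝ) < n by exact_mod_cast hn) k
    positivity
  have hj : ∀ j, ‖regPoly k (toC ω) (toC x) j‖ ≤ Real.exp 2 * (k + 1) * negBinom n k := by
    intro j
    have h := norm_fderiv_single_le_of_homogeneous (k := k) n.succ_pos
      (f := fun z => MvPolynomial.eval z (potential k (toC ω)))
      ((contDiff_eval _).differentiable one_ne_zero)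
      (fun t z => eval_smul_of_isHomogeneous (isHomogeneous_potential k _) t z)
      (fun x hx => norm_eval_potential_le hn k hω hx) hx j
    rw [fderiv_eval_single] at h
    rw [regPoly, conjGrad_apply]
    by_cases hj : j = 0
    · simpa [hj] using h
    · simpa [hj] using h
  rw [hnorm, sphereBound, ← Real.sqrt_sq hb, ← Real.sqrt_mul (by positivity)]
  refine Real.sqrt_le_sqrt ?_
  calc _ ≤ ∑ _j : Fin (n + 1), (Real.exp 2 * (k + 1) * negBinom n k) ^ 2 :=
        Finset.sum_le_sum fun j _ => pow_le_pow_left₀ (norm_nonneg _) (hj j) 2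
    _ = _ := by simp

lemma differentiable_regPoly_left (k : ℕ) (z : Fin (n + 1) → ℂ) :
    Differentiable ℂ (fun σ : Fin n → ℂ => regPoly k σ z) := by
  have h : ContDiff ℂ 1 (fun σ : Fin n → ℂ => (σ, z)) := by fun_prop
  exact ((contDiff_regPoly k).comp h).differentiable one_ne_zero

lemma differentiable_regPoly_right (k : ℕ) (σ : Fin n → ℂ) : Differentiable ℂ (regPoly k σ) :=
  (contDiffOn_univ.1 (leftComplexRegularOn_regPoly k σ).1).differentiable one_ne_zero

/-- The maximum principle `norm_le_lieNorm_pow_mul` for the Hermitian norm of vector-valued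
maps. -/
lemma hnorm_le_lieNorm_pow_mul {m l k : ℕ} (hm : 0 < m) {f : (Fin m → ℂ) → (Fin l → ℂ)}
    (hf : Differentiable ℂ f) (hom : ∀ (t : ℂ) z, f (t • z) = t ^ k • f z) {M : ℝ}
    (hM : ∀ x ∈ unitSphere m, hnorm (f (toC x)) ≤ M) (z : Fin m → ℂ) :
    hnorm (f z) ≤ lieNorm z ^ k * M := by
  simp only [hnorm_eq_norm] at hM ⊢
  have h : Differentiable ℂ fun z => WithLp.toLp 2 (f z) :=
    (PiLp.continuousLinearEquiv 2 ℂ (fun _ : Fin l => ℂ)).symm.differentiable.comp hf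
  exact norm_le_lieNorm_pow_mul hm h (fun t z => by rw [hom, WithLp.toLp_smul]) hM z

/-- The maximum principle for the Lie norm, applied in each of the two variables. -/
lemma hnorm_regPoly_le (hn : 1 ≤ n) (k : ℕ) (σ : Fin n → ℂ) (z : Fin (n + 1) → ℂ) :
    hnorm (regPoly k σ z) ≤ (lieNorm σ * lieNorm z) ^ k * sphereBound n k := by
  have h1 : ∀ ω ∈ unitSphere n, hnorm (regPoly k (toC ω) z) ≤ lieNorm z ^ k * sphereBound n k :=
    fun ω hω => hnorm_le_lieNorm_pow_mul (f := regPoly k (toC ω)) n.succ_pos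
      (differentiable_regPoly_right k (toC ω)) (fun t z => regPoly_smul_right k t (toC ω) z)
      (fun x hx => hnorm_regPoly_toC_le hn k hω hx) z
  have h2 := hnorm_le_lieNorm_pow_mul (f := fun σ => regPoly k σ z) hn
    (differentiable_regPoly_left k z) (fun t σ => regPoly_smul_left k t σ z) h1 σ
  rwa [← mul_assoc, ← mul_pow] at h2

lemma summable_pow_mul_sphereBound (hn : 1 ≤ n) {ρ : ℝ} (h0 : 0 < ρ) (h1 : ρ < 1) :
    Summable (fun k => ρ ^ k * sphereBound n k) := by
  have hs : Summable (fun k : ℕ => ((k + 1 : ℕ) : ℝ) ^ n * ρ ^ (k + 1)) :=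
    (summable_nat_add_iff (f := fun k : ℕ => (k : ℝ) ^ n * ρ ^ k) 1).2
      (summable_pow_mul_geometric_of_norm_lt_one n (by rwa [Real.norm_of_nonneg h0.le]))
  have hpos := fun k => negBinom_pos (show (0 : ℝ) < n by exact_mod_cast hn) k
  refine Summable.of_nonneg_of_le (fun k => ?_) (fun k => ?_)
    (hs.mul_left (Real.sqrt (n + 1) * Real.exp 2 * n ^ (n - 1) / ρ))
  · have := hpos k
    unfold sphereBound
    positivity
  · have e : ((k : ℝ) + 1) ^ n = (k + 1) ^ (n - 1) * (k + 1) := by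
      rw [← pow_succ, Nat.sub_add_cancel hn]
    calc ρ ^ k * sphereBound n k
        ≤ ρ ^ k * (Real.sqrt (n + 1) * (Real.exp 2 * (k + 1) * (n * (k + 1)) ^ (n - 1))) := by
          unfold sphereBound
          gcongr
          exact negBinom_natCast_le hn k
      _ = _ := by
          push_cast
          rw [e, mul_pow, pow_succ ρ]
          field_simp

end Growth

/-! ### Legendre polynomials -/

section Legendre

variable {n : ℕ}

lemma cnorm_sq {m : ℕ} (z : Fin m → ℂ) : cnorm z ^ 2 = bilin z z := by
  rw [cnorm, one_div]
  exact_mod_cast Complex.cpow_nat_inv_pow (bilin z z) two_ne_zero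

lemma legendreP_add_two (hn : 1 ≤ n) (k : ℕ) (t : ℂ) :
    legendreP k (n + 2) t = (negBinom n k : ℂ)⁻¹ * geg (n / 2) k t 1 := by
  have hn0 : (n : ℂ) ≠ 0 := by exact_mod_cast (show n ≠ 0 by omega)
  have hb : (negBinom n k : ℂ) ≠ 0 := by
    exact_mod_cast (negBinom_pos (show (0 : ℝ) < n by exact_mod_cast hn) k).ne'
  have hk : (2 * k + n : ℂ) ≠ 0 := by exact_mod_cast (show 2 * k + n ≠ 0 by omega)
  rw [legendreP, ← iteratedDeriv_gegenbauer, dimHarm_add_two hn]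
  have e : -((((n + 2 : ℕ) : ℂ) - 2) / 2) = -(((n : ℝ) / 2 : ℝ) : ℂ) := by push_cast; ring
  rw [e]
  congr 1
  push_cast
  rw [show (2 * k + (n + 2) - 2 : ℂ) = 2 * k + n by ring, show ((n : ℂ) + 2 - 2) = n by ring]
  field_simp

lemma cnorm_pow_mul_legendreP (hn : 1 ≤ n) (k : ℕ) (σ z : Fin n → ℂ) (hz : cnorm z ≠ 0) :
    cnorm z ^ k * legendreP k (n + 2) (bilin σ ((cnorm z)⁻¹ • z)) =
      (negBinom n k : ℂ)⁻¹ * geg (n / 2) k (bilin σ z) (bilin z z) := by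
  have e : bilin σ z = cnorm z * bilin σ ((cnorm z)⁻¹ • z) := by
    have := bilin_smul_smul 1 (cnorm z)⁻¹ σ z
    rw [one_smul] at this
    rw [this]
    field_simp
  rw [legendreP_add_two hn, mul_left_comm, ← geg_mul_sq, ← e, mul_one, cnorm_sq]

lemma dense_cnorm_ne_zero (hn : 1 ≤ n) : Dense {z : Fin n → ℂ | cnorm z ≠ 0} := by
  intro z
  -- on the line `z + t e_i` the form is a monic quadratic polynomial in `t`, with two zeros
  let i : Fin n := ⟨0, hn⟩
  obtain ⟨A, B, h1, h2⟩ := exists_add_eq_mul_eq (z i) (bilin z z)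
  have hdense : (0 : ℂ) ∈ closure ({-A, -B}ᶜ : Set ℂ) :=
    (Set.toFinite ({-A, -B} : Set ℂ)).countable.dense_compl ℂ 0
  have hc : Continuous (fun t : ℂ => z + t • (Pi.single i 1 : Fin n → ℂ)) := by fun_prop
  have := map_mem_closure (t := {z : Fin n → ℂ | cnorm z ≠ 0}) hc hdense fun t ht h0 => ht ?_
  · simpa using this
  have hb : bilin (z + t • (Pi.single i 1 : Fin n → ℂ)) (z + t • (Pi.single i 1 : Fin n → ℂ)) =
      (t + A) * (t + B) := by
    have : (t + A) * (t + B) = bilin z z + 2 * t * z i + t ^ 2 := by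
      rw [← h2]; linear_combination t * h1
    rw [this]
    have e : ∀ j, (z + t • (Pi.single i 1 : Fin n → ℂ)) j * (z + t • (Pi.single i 1 : Fin n → ℂ)) j =
        z j * z j + if j = i then 2 * t * z j + t ^ 2 else 0 := by
      intro j
      by_cases h : j = i
      · subst h; simp; ring
      · simp [h]
    simp only [bilin, e, Finset.sum_add_distrib, Finset.sum_ite_eq', Finset.mem_univ, if_true]
    ring
  rw [← cnorm_sq, h0] at hb
  have : (t + A) * (t + B) = 0 := by rw [← hb]; ring
  rcases mul_eq_zero.1 this with h | h
  · exact Or.inl (eq_neg_of_add_eq_zero_left h)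
  · exact Or.inr (eq_neg_of_add_eq_zero_left h)

end Legendre

/-! ### The homogeneous regular extensions of the Legendre polynomials -/

section Homogeneous

variable {n : ℕ}

/-- The regular extension `W_{k,n+2}(ω; ·)` of the Legendre polynomial, for `ω` on the unit sphere.
The normalizing factor `negBinom n k` is the value at `1` of the Gegenbauer polynomial. -/
noncomputable def legendreExt (k : ℕ) (ω : Fin n → ℝ) (z : Fin (n + 1) → ℂ) : Fin (n + 1) → ℂ :=
  (negBinom n k : ℂ)⁻¹ • regPoly k (toC ω) z

lemma leftComplexRegularOn_const_smul {f : (Fin (n + 1) → ℂ) → (Fin (n + 1) → ℂ)}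
    (hf : LeftComplexRegularOn f Set.univ) (c : ℂ) :
    LeftComplexRegularOn (fun z => c • f z) Set.univ := by
  refine ⟨hf.1.const_smul c, fun z hz => ?_⟩
  have hd : DifferentiableAt ℂ f z := (contDiffOn_univ.1 hf.1).differentiable one_ne_zero z
  have h := hf.2 z hz
  unfold dirac at h ⊢
  simp only [fderiv_fun_const_smul hd, smul_apply, Pi.smul_apply, smul_assoc, ← Finset.smul_sum, h,
    smul_zero]

theorem isHomogeneousRegularExtension_legendreExt (hn : 1 ≤ n) (k : ℕ) {ω : Fin n → ℝ}
    (hω : ω ∈ unitSphere n) : IsHomogeneousRegularExtension k ω (legendreExt k ω) where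
  homogeneous j := by
    obtain ⟨p, hp, h⟩ := exists_isHomogeneous_regPoly k (toC ω) j
    exact ⟨MvPolynomial.C (negBinom n k : ℂ)⁻¹ * p, hp.C_mul _, fun z => by
      simp [legendreExt, h]⟩
  regular := leftComplexRegularOn_const_smul (leftComplexRegularOn_regPoly k _) _
  extends_legendre z hz := by
    rw [legendreExt, regPoly_cons_zero, cnorm_pow_mul_legendreP hn k _ z hz, bilin_toC_self hω,
      one_mul]
    funext j
    refine Fin.cases ?_ (fun i => ?_) j <;> simp

/-- The defining condition, imposed where `|z|_ℂ ≠ 0`, extends to `z₀ = 0` by density. -/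
theorem IsHomogeneousRegularExtension.unique (hn : 1 ≤ n) {k : ℕ} {ω : Fin n → ℝ}
    {V W : (Fin (n + 1) → ℂ) → (Fin (n + 1) → ℂ)} (hV : IsHomogeneousRegularExtension k ω V)
    (hW : IsHomogeneousRegularExtension k ω W) : V = W := by
  have hcont : ∀ {f : (Fin (n + 1) → ℂ) → (Fin (n + 1) → ℂ)}, LeftComplexRegularOn f Set.univ →
      Continuous fun w : Fin n → ℂ => f (Fin.cons 0 w) := fun hf =>
    (contDiffOn_univ.1 hf.1).continuous.comp (by fun_prop)
  have h : (fun w : Fin n → ℂ => V (Fin.cons 0 w)) = fun w => W (Fin.cons 0 w) :=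
    (hcont hV.regular).ext_on (dense_cnorm_ne_zero hn) (hcont hW.regular) fun w hw =>
      (hV.extends_legendre w hw).trans (hW.extends_legendre w hw).symm
  funext z
  refine eqOn_of_regular isOpen_univ trivial (fun z _ => ?_) hV.regular hW.regular
    (fun w _ => congrFun h w) (Set.mem_univ z)
  simpa using isPreconnected_univ

end Homogeneous

/-! ### The regular extension of the Cauchy–Hua kernel -/

section Kernel

variable {n : ℕ}

/-- The map `σ ↦ σ / ⟨σ, σ⟩`, holomorphic off the isotropic cone, which is complex conjugation on the
Lie sphere. -/
noncomputable def conjLie (σ : Fin n → ℂ) : Fin n → ℂ := (bilin σ σ)⁻¹ • σ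

/-- The regular extension of the Cauchy–Hua kernel. The conjugate of `σ` enters through `conjLie`,
which makes the terms holomorphic in `σ`. -/
noncomputable def regKernel (σ : Fin n → ℂ) (z : Fin (n + 1) → ℂ) : Fin (n + 1) → ℂ :=
  ∑' k, regPoly k (conjLie σ) z

/-- A neighbourhood of `Σ_n × L_{n+1}` on which the series `regKernel` converges. -/
def kernelDomain (n : ℕ) : Set ((Fin n → ℂ) × (Fin (n + 1) → ℂ)) :=
  {q | bilin q.1 q.1 ≠ 0 ∧ lieNorm (conjLie q.1) * lieNorm q.2 < 1}

lemma conjLie_lieSpherePoint (θ : ℝ) {ω : Fin n → ℝ} (hω : ω ∈ unitSphere n) :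
    conjLie (lieSpherePoint θ ω) = Complex.exp (-(Complex.I * θ)) • toC ω := by
  rw [conjLie, lieSpherePoint, bilin_smul_smul, bilin_toC_self hω, smul_smul, Complex.exp_neg]
  congr 1
  have := Complex.exp_ne_zero (Complex.I * θ)
  field_simp

lemma bilin_lieSpherePoint_ne_zero (θ : ℝ) {ω : Fin n → ℝ} (hω : ω ∈ unitSphere n) :
    bilin (lieSpherePoint θ ω) (lieSpherePoint θ ω) ≠ 0 := by
  rw [lieSpherePoint, bilin_smul_smul, bilin_toC_self hω]
  simp [Complex.exp_ne_zero]

lemma norm_exp_neg_I_mul (θ : ℝ) : ‖Complex.exp (-(Complex.I * θ))‖ = 1 := by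
  rw [show -(Complex.I * θ) = ((-θ : ℝ) : ℂ) * Complex.I by push_cast; ring,
    Complex.norm_exp_ofReal_mul_I]

lemma mk_mem_kernelDomain {σ : Fin n → ℂ} (hσ : σ ∈ lieSphere n) {z : Fin (n + 1) → ℂ}
    (hz : z ∈ lieBall (n + 1)) : (σ, z) ∈ kernelDomain n := by
  obtain ⟨θ, ω, hω, rfl⟩ := hσ
  refine ⟨bilin_lieSpherePoint_ne_zero θ hω, ?_⟩
  rw [conjLie_lieSpherePoint θ hω, lieNorm_smul, norm_exp_neg_I_mul, lieNorm_toC hω, one_mul,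
    one_mul]
  exact mem_lieBall_iff.1 hz

lemma contDiffOn_conjLie : ContDiffOn ℂ 1 (conjLie : (Fin n → ℂ) → _) {σ | bilin σ σ ≠ 0} := by
  have h : ContDiff ℂ 1 (fun σ : Fin n → ℂ => bilin σ σ) := by unfold bilin; fun_prop
  exact (h.contDiffOn.inv fun σ hσ => hσ).smul contDiffOn_id

lemma continuousOn_lieNorm_conjLie_mul : ContinuousOn
    (fun q : (Fin n → ℂ) × (Fin (n + 1) → ℂ) => lieNorm (conjLie q.1) * lieNorm q.2)
    {q | bilin q.1 q.1 ≠ 0} :=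
  (continuous_lieNorm.comp_continuousOn
    (contDiffOn_conjLie.continuousOn.comp continuousOn_fst fun _ hq => hq)).mul
    (continuous_lieNorm.comp continuous_snd).continuousOn

lemma isOpen_bilin_ne_zero :
    IsOpen {q : (Fin n → ℂ) × (Fin (n + 1) → ℂ) | bilin q.1 q.1 ≠ 0} := by
  have h : Continuous (fun q : (Fin n → ℂ) × (Fin (n + 1) → ℂ) => bilin q.1 q.1) := by
    unfold bilin; fun_prop
  exact isOpen_ne_fun h continuous_const

lemma isOpen_kernelDomain (n : ℕ) : IsOpen (kernelDomain n) :=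
  continuousOn_lieNorm_conjLie_mul.isOpen_inter_preimage isOpen_bilin_ne_zero isOpen_Iio

/-- The series `regKernel` is locally dominated by a convergent series of constants. -/
lemma exists_summable_bound (hn : 1 ≤ n) {q : (Fin n → ℂ) × (Fin (n + 1) → ℂ)}
    (hq : q ∈ kernelDomain n) : ∃ t ∈ 𝓝 q, ∃ u : ℕ → ℝ, Summable u ∧
      ∀ k, ∀ r ∈ t, ‖regPoly k (conjLie r.1) r.2‖ ≤ u k := by
  obtain ⟨ρ, h1, h2⟩ := exists_between hq.2
  have hnn : ∀ r : (Fin n → ℂ) × (Fin (n + 1) → ℂ), 0 ≤ lieNorm (conjLie r.1) * lieNorm r.2 :=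
    fun r => mul_nonneg (lieNorm_nonneg _) (lieNorm_nonneg _)
  have hev : ∀ᶠ r in 𝓝 q, lieNorm (conjLie r.1) * lieNorm r.2 < ρ :=
    (continuousOn_lieNorm_conjLie_mul.continuousAt
      (isOpen_bilin_ne_zero.mem_nhds hq.1)).eventually_lt continuousAt_const h1
  refine ⟨_, hev, _, summable_pow_mul_sphereBound hn ((hnn q).trans_lt h1) h2, fun k r hr => ?_⟩
  refine (norm_le_hnorm _).trans ((hnorm_regPoly_le hn k _ _).trans ?_)
  have hB : 0 ≤ sphereBound n k := by
    have := negBinom_pos (show (0 : ℝ) < n by exact_mod_cast hn) k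
    unfold sphereBound; positivity
  exact mul_le_mul_of_nonneg_right (pow_le_pow_left₀ (hnn r) (le_of_lt hr) k) hB

lemma hasSum_regKernel (hn : 1 ≤ n) {σ : Fin n → ℂ} (hσ : σ ∈ lieSphere n) {z : Fin (n + 1) → ℂ}
    (hz : z ∈ lieBall (n + 1)) :
    HasSum (fun k => regPoly k (conjLie σ) z) (regKernel σ z) := by
  obtain ⟨t, ht, u, hu, hb⟩ := exists_summable_bound hn (mk_mem_kernelDomain hσ hz)
  exact (Summable.of_norm_bounded hu fun k => hb k _ (mem_of_mem_nhds ht)).hasSum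

lemma differentiableOn_regKernel (hn : 1 ≤ n) :
    DifferentiableOn ℂ (fun q : (Fin n → ℂ) × (Fin (n + 1) → ℂ) => regKernel q.1 q.2)
      (kernelDomain n) := by
  have h0 : ContDiffOn ℂ 1 (fun q : (Fin n → ℂ) × (Fin (n + 1) → ℂ) => conjLie q.1)
      (kernelDomain n) :=
    contDiffOn_conjLie.comp contDiffOn_fst fun q hq => hq.1
  have h : ContDiffOn ℂ 1 (fun q : (Fin n → ℂ) × (Fin (n + 1) → ℂ) => (conjLie q.1, q.2))
      (kernelDomain n) :=
    h0.prodMk contDiffOn_snd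
  have hf : ∀ k, ContDiffOn ℂ 1
      (fun q : (Fin n → ℂ) × (Fin (n + 1) → ℂ) => regPoly k (conjLie q.1) q.2) (kernelDomain n) :=
    fun k => ContDiff.comp_contDiffOn
      (g := fun q : (Fin n → ℂ) × (Fin (n + 1) → ℂ) => regPoly k q.1 q.2)
      (f := fun q : (Fin n → ℂ) × (Fin (n + 1) → ℂ) => (conjLie q.1, q.2)) (contDiff_regPoly k) h
  exact (contDiffOn_tsum_of_locally_bounded (isOpen_kernelDomain n) hf
    fun q hq => exists_summable_bound hn hq).1.differentiableOn one_ne_zero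

lemma leftComplexRegularOn_regKernel (hn : 1 ≤ n) {σ : Fin n → ℂ} (hσ : σ ∈ lieSphere n) :
    LeftComplexRegularOn (regKernel σ) (lieBall (n + 1)) := by
  refine leftComplexRegularOn_tsum (isOpen_lieBall _) (fun k => ?_) fun z hz => ?_
  · have h := leftComplexRegularOn_regPoly k (conjLie σ)
    exact ⟨h.1.mono (Set.subset_univ _), fun z _ => h.2 z (Set.mem_univ z)⟩
  · obtain ⟨t, ht, u, hu, hb⟩ := exists_summable_bound hn (mk_mem_kernelDomain hσ hz)
    have hc : Continuous fun z : Fin (n + 1) → ℂ => (σ, z) := by fun_prop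
    exact ⟨_, hc.continuousAt.preimage_mem_nhds ht, u, hu, fun k y hy => hb k (σ, y) hy⟩

lemma jointlyAnalytic_regKernel (hn : 1 ≤ n) : JointlyAnalytic (n := n) regKernel :=
  ⟨kernelDomain n, isOpen_kernelDomain n, fun _ hq => mk_mem_kernelDomain hq.1 hq.2, _,
    differentiableOn_regKernel hn, fun _ _ _ _ => rfl⟩

lemma analyticOnLieSphere_regKernel (hn : 1 ≤ n) {z : Fin (n + 1) → ℂ} (hz : z ∈ lieBall (n + 1)) :
    AnalyticOnLieSphere (fun σ => regKernel σ z) :=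
  ⟨(fun σ => (σ, z)) ⁻¹' kernelDomain n, (isOpen_kernelDomain n).preimage (by fun_prop),
    fun _ hσ => mk_mem_kernelDomain hσ hz, _,
    (differentiableOn_regKernel hn).comp (by fun_prop) fun _ hσ => hσ, fun _ _ => rfl⟩

lemma bilin_sub_sub {m : ℕ} (z w : Fin m → ℂ) :
    bilin (z - w) (z - w) = bilin z z - 2 * bilin z w + bilin w w := by
  simp only [bilin, Finset.mul_sum, ← Finset.sum_sub_distrib, ← Finset.sum_add_distrib]
  exact Finset.sum_congr rfl fun i _ => by simp only [Pi.sub_apply]; ring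

/-- On `z₀ = 0` the series is the Gegenbauer expansion of the Cauchy–Hua kernel. -/
lemma regKernel_lieSpherePoint_cons_zero (hn : 1 ≤ n) (θ : ℝ) {ω : Fin n → ℝ}
    (hω : ω ∈ unitSphere n) {z : Fin n → ℂ} (hz : z ∈ lieBall n) :
    regKernel (lieSpherePoint θ ω) (Fin.cons 0 z) = Fin.cons (cauchyHua θ ω z) 0 := by
  set u := Complex.exp (-(Complex.I * θ)) with hu
  have hz' : (Fin.cons 0 z : Fin (n + 1) → ℂ) ∈ lieBall (n + 1) := by
    rw [lieBall, Set.mem_ofPred_eq, lieNormSq_cons_zero]; exact hz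
  have huz : u • z ∈ lieBall n := by
    rw [mem_lieBall_iff, lieNorm_smul, hu, norm_exp_neg_I_mul, one_mul]
    exact mem_lieBall_iff.1 hz
  obtain ⟨A, B, h1, h2⟩ := exists_add_eq_mul_eq (bilin (toC ω) (u • z)) (bilin (u • z) (u • z))
  have hA := norm_lt_one_of_mem_lieBall hω huz h1 h2
  have hB := norm_lt_one_of_mem_lieBall hω huz ((add_comm B A).trans h1) ((mul_comm B A).trans h2)
  have hs := hasSum_geg ((n : ℝ) / 2) h1 h2 hA hB
  have hval : (1 - 2 * bilin (toC ω) (u • z) + bilin (u • z) (u • z)) ^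
      (-(((n : ℝ) / 2 : ℝ) : ℂ)) = cauchyHua θ ω z := by
    -- `(c^{1/2})^n = c^{n/2}` holds for the principal branch without restriction on `c`
    rw [cauchyHua, cnorm, bilin_sub_sub, bilin_toC_self hω, ← Complex.cpow_nat_mul,
      ← Complex.cpow_neg]
    congr 1
    push_cast
    ring
  rw [hval] at hs
  have hk := hasSum_regKernel hn ⟨θ, ω, hω, rfl⟩ hz'
  refine hk.unique (Pi.hasSum.2 fun j => ?_)
  simp only [regPoly_cons_zero]
  refine Fin.cases ?_ (fun i => ?_) j
  · simp only [Fin.cons_zero]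
    convert hs using 2 with k
    have e1 : bilin (u • toC ω) z = bilin (toC ω) (u • z) := by
      have e := bilin_smul_smul u 1 (toC ω) z
      have e' := bilin_smul_smul 1 u (toC ω) z
      rw [one_smul] at e e'
      rw [e, e']; ring
    rw [conjLie_lieSpherePoint θ hω, ← hu, e1, bilin_smul_smul, bilin_smul_smul,
      bilin_toC_self hω, mul_one]
  · simp

theorem isRegularExtension_regKernel (hn : 1 ≤ n) : IsRegularExtension (n := n) regKernel where
  analytic _ hz := analyticOnLieSphere_regKernel hn hz
  regular _ hσ := leftComplexRegularOn_regKernel hn hσ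
  extends_kernel θ _ hω _ hz := regKernel_lieSpherePoint_cons_zero hn θ hω hz

/-- Regularity in `z` and the values on `z₀ = 0` already determine a regular extension. -/
theorem IsRegularExtension.eq_of_mem
    {F G : (Fin n → ℂ) → (Fin (n + 1) → ℂ) → (Fin (n + 1) → ℂ)} (hF : IsRegularExtension F)
    (hG : IsRegularExtension G) {σ : Fin n → ℂ} (hσ : σ ∈ lieSphere n) {z : Fin (n + 1) → ℂ}
    (hz : z ∈ lieBall (n + 1)) : F σ z = G σ z := by
  refine eqOn_of_regular (isOpen_lieBall _) (zero_mem_lieBall _) (fun z _ => ?_)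
    (hF.regular σ hσ) (hG.regular σ hσ) (fun w hw => ?_) hz
  · -- complex lines through the origin meet the Lie ball in discs
    have e : {t : ℂ | t • z ∈ lieBall (n + 1)} =
        LinearMap.mulRight ℝ (lieNorm z : ℂ) ⁻¹' Metric.ball 0 1 := by
      ext t
      simp [mem_lieBall_iff, lieNorm_smul, abs_of_nonneg (lieNorm_nonneg z)]
    rw [e]
    exact ((convex_ball (0 : ℂ) 1).linear_preimage _).isPreconnected
  · obtain ⟨θ, ω, hω, rfl⟩ := hσ
    have hw' : w ∈ lieBall n := by
      rwa [lieBall, Set.mem_ofPred_eq, lieNormSq_cons_zero] at hw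
    rw [hF.extends_kernel θ ω hω w hw', hG.extends_kernel θ ω hω w hw']

lemma hasSum_legendreExt (hn : 1 ≤ n) (θ : ℝ) {ω : Fin n → ℝ} (hω : ω ∈ unitSphere n)
    {z : Fin (n + 1) → ℂ} (hz : z ∈ lieBall (n + 1)) :
    HasSum (fun k : ℕ => (((n : ℂ) / (2 * k + n)) * (dimHarm k (n + 2) : ℂ) *
      Complex.exp (-(Complex.I * k * θ))) • legendreExt k ω z)
      (regKernel (lieSpherePoint θ ω) z) := by
  convert hasSum_regKernel hn ⟨θ, ω, hω, rfl⟩ hz using 2 with k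
  have hn0 : (n : ℂ) ≠ 0 := by exact_mod_cast (show n ≠ 0 by omega)
  have hb : (negBinom n k : ℂ) ≠ 0 := by
    exact_mod_cast (negBinom_pos (show (0 : ℝ) < n by exact_mod_cast hn) k).ne'
  have hk : (2 * k + n : ℂ) ≠ 0 := by exact_mod_cast (show 2 * k + n ≠ 0 by omega)
  rw [conjLie_lieSpherePoint θ hω, regPoly_smul_left, legendreExt, smul_smul, dimHarm_add_two hn,
    ← Complex.exp_nat_mul]
  congr 1
  rw [show (k : ℂ) * -(Complex.I * θ) = -(Complex.I * k * θ) by ring]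
  push_cast
  field_simp

lemma hnorm_legendreExt_toC_le (hn : 1 ≤ n) (k : ℕ) {ω : Fin n → ℝ} (hω : ω ∈ unitSphere n)
    {x : Fin (n + 1) → ℝ} (hx : x ∈ unitSphere (n + 1)) :
    hnorm (legendreExt k ω (toC x)) ≤ Real.sqrt (n + 1) * Real.exp 2 * (k + 1) := by
  have hb := negBinom_pos (show (0 : ℝ) < n by exact_mod_cast hn) k
  have h := hnorm_regPoly_toC_le hn k hω hx
  rw [legendreExt, hnorm_smul, norm_inv, Complex.norm_real, Real.norm_of_nonneg hb.le,
    inv_mul_le_iff₀ hb]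
  refine h.trans (le_of_eq ?_)
  rw [sphereBound]; ring

lemma hnorm_legendreExt_le {k : ℕ} {ω : Fin n → ℝ} {M : ℝ}
    (hM : ∀ x ∈ unitSphere (n + 1), hnorm (legendreExt k ω (toC x)) ≤ M) (z : Fin (n + 1) → ℂ) :
    hnorm (legendreExt k ω z) ≤ lieNorm z ^ k * M := by
  have hd : Differentiable ℂ (legendreExt k ω) :=
    (differentiable_regPoly_right k (toC ω)).const_smul (negBinom n k : ℂ)⁻¹
  exact hnorm_le_lieNorm_pow_mul n.succ_pos hd
    (fun t z => by rw [legendreExt, regPoly_smul_right, smul_comm, ← legendreExt]) hM z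

end Kernel

end LieBallCR

open LieBallCR
theorem mainTheorem2 (n : ℕ) (hn : 1 ≤ n) :
    ∃ F : (Fin n → ℂ) → (Fin (n + 1) → ℂ) → (Fin (n + 1) → ℂ),
      IsRegularExtension F ∧
      (∀ G : (Fin n → ℂ) → (Fin (n + 1) → ℂ) → (Fin (n + 1) → ℂ), IsRegularExtension G →
        ∀ σ ∈ lieSphere n, ∀ z ∈ lieBall (n + 1), G σ z = F σ z) ∧
      JointlyAnalytic F ∧
      ∃ W : ℕ → (Fin n → ℝ) → (Fin (n + 1) → ℂ) → (Fin (n + 1) → ℂ),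
        (∀ k, ∀ ω ∈ unitSphere n, IsHomogeneousRegularExtension k ω (W k ω) ∧
          ∀ V, IsHomogeneousRegularExtension k ω V → V = W k ω) ∧
        (∀ θ : ℝ, ∀ ω ∈ unitSphere n, ∀ z ∈ lieBall (n + 1),
          HasSum (fun k : ℕ =>
            (((n : ℂ) / (2 * k + n)) * (dimHarm k (n + 2) : ℂ) *
              Complex.exp (-(Complex.I * k * θ))) • W k ω z)
            (F (lieSpherePoint θ ω) z)) ∧
        (∃ C : ℝ, ∀ k : ℕ, 1 ≤ k → ∀ ω ∈ unitSphere n, ∀ x ∈ unitSphere (n + 1),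
          hnorm (W k ω (toC x)) ≤ C * (k : ℝ) ^ 2) ∧
        (∃ C : ℝ, ∀ k : ℕ, 1 ≤ k → dimHarm k (n + 2) ≤ C * (k : ℝ) ^ n) ∧
        (∀ k, ∀ ω ∈ unitSphere n, ∀ M : ℝ,
          (∀ x ∈ unitSphere (n + 1), hnorm (W k ω (toC x)) ≤ M) →
          ∀ z, hnorm (W k ω z) ≤ lieNorm z ^ k * M) := by
  refine ⟨regKernel, isRegularExtension_regKernel hn,
    fun G hG σ hσ z hz => hG.eq_of_mem (isRegularExtension_regKernel hn) hσ hz,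
    jointlyAnalytic_regKernel hn, legendreExt,
    fun k ω hω => ⟨isHomogeneousRegularExtension_legendreExt hn k hω,
      fun V hV => hV.unique hn (isHomogeneousRegularExtension_legendreExt hn k hω)⟩,
    fun θ ω hω z hz => hasSum_legendreExt hn θ hω hz,
    ⟨Real.sqrt (n + 1) * Real.exp 2 * 2, fun k hk ω hω x hx => ?_⟩,
    ⟨3 * (2 * n) ^ (n - 1), fun k hk => dimHarm_le hn hk⟩,
    fun k ω _ M hM z => hnorm_legendreExt_le hM z⟩
  refine (hnorm_legendreExt_toC_le hn k hω hx).trans ?_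
  have hk' : (1 : ℝ) ≤ k := by exact_mod_cast hk
  rw [mul_assoc (Real.sqrt (n + 1) * Real.exp 2)]
  gcongr
  nlinarith
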